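/- Let $n\in\mathbb N$, let $p$ be a real number with $p>n$, and let $\Omega_x,\Omega_y\subset\mathbb R^n$ be open. Let $y:\Omega_x\to\Omega_y$ be a coordinate transformation, that is, a $C^1$ diffeomorphism, with Jacobian $J=(\partial y^\alpha/\partial x^\mu)$ and inverse Jacobian $J^{-1}=(\partial x^\mu/\partial y^\alpha)$, and assume $J\in W^{1,p}(\Omega_x)$, with weak derivatives $\tfrac{\partial}{\partial x^\rho}\tfrac{\partial y^\alpha}{\partial x^\nu}$. Repeated indices are summed from $1$ to $n$. For functions $\Gamma^\mu_{\nu\rho}\in L^{2p}(\Omega)$ on an open set $\Omega\subset\mathbb R^n$ and $\psi\in C_0^\infty(\Omega)$, define the weak curvature $$\mathrm{Riem}(\Gamma)[\psi]^\mu_{\nu\rho\tau}=-\int_\Omega\Big(\Gamma^\mu_{\nu\rho}\,\frac{\partial\psi}{\partial x^\tau}-\Gamma^\mu_{\nu\tau}\,\frac{\partial\psi}{\partial x^\rho}\Big)dx+\int_\Omega\big(\Gamma^\mu_{\sigma\tau}\Gamma^\sigma_{\nu\rho}-\Gamma^\mu_{\sigma\rho}\Gamma^\sigma_{\nu\tau}\big)\,\psi\,dx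 .$$ We write $\mathrm{Riem}(\Gamma)=\mathcal R$ on $\Omega$ if $\mathrm{Riem}(\Gamma)[\psi]^\mu_{\nu\rho\tau}=\int_\Omega\mathcal R^\mu_{\nu\rho\tau}\,\psi\,dx$ for all $\psi\in C_0^\infty(\Omega)$ and all indices. Let $\Gamma_x\in L^{2p}(\Omega_x)$ and $\Gamma_y\in L^{2p}(\Omega_y)$ (no symmetry is assumed) be related almost everywhere in $\Omega_x$ by the connection transformation law $$(\Gamma_x)^\mu_{\rho\nu}=\frac{\partial x^\mu}{\partial y^\alpha}\Big(\frac{\partial y^\beta}{\partial x^\rho}\frac{\partial y^\gamma}{\partial x^\nu}\,(\Gamma_y)^\alpha_{\beta\gamma}+\frac{\partial}{\partial x^\rho}\frac{\partial y^\alpha}{\partial x^\nu}\Big),$$ and assume $\mathrm{Riem}(\Gamma_x)=\mathcal R_x$ on $\Omega_x$ for functions $\mathcal R_x\in L^p(\Omega_x)$. Let $\mathcal R_y$ be defined on $\Omega_y$ (up to null sets) by the tensor transformation law, almost everywhere in $\Omega_x$, $$(\mathcal R_x)^\tau_{\mu\nu\rho}=\frac{\partial x^\tau}{\partial y^\delta}\frac{\partial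 y^\alpha}{\partial x^\mu}\frac{\partial y^\beta}{\partial x^\nu}\frac{\partial y^\gamma}{\partial x^\rho}\,(\mathcal R_y)^\delta_{\alpha\beta\gamma}.$$ Then $\mathcal R_y\in L^p(K)$ for every compact $K\subset\Omega_y$, and $\mathrm{Riem}(\Gamma_y)=\mathcal R_y$ on $\Omega_y$. Moreover $\mathcal R_y\in L^p(\Omega_y)$ whenever the coordinate transformation is non-degenerate up to the boundary in one of the following two senses: (a) $\Omega_x$ satisfies the interior cone condition (as every bounded Lipschitz domain does) and $J^{-1}$, as a function of $x$, lies in $W^{1,p}(\Omega_x)$; or (b) $J$ and $J^{-1}$ are bounded. -/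

import Mathlib

open MeasureTheory
open scoped ContDiff

noncomputable section

namespace WeakCurvature

/-- Coordinate space `ℝⁿ` with its Euclidean norm. -/
abbrev Coord (n : ℕ) : Type := EuclideanSpace ℝ (Fin n)

/-- The classical partial derivative `∂f/∂xⁱ` at `x`. -/
def pderiv {n : ℕ} (i : Fin n) (f : Coord n → ℝ) (x : Coord n) : ℝ :=
  fderiv ℝ f x (EuclideanSpace.single i 1)

/-- `ψ ∈ C₀^∞(Ω)`: a smooth real function with compact support contained in `Ω`. -/
def IsTestFunction {n : ℕ} (Ω : Set (Coord n)) (ψ : Coord n → ℝ) : Prop :=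
  ContDiff ℝ ∞ ψ ∧ HasCompactSupport ψ ∧ tsupport ψ ⊆ Ω

/-- `f ∈ L^q(Ω)` for a real exponent `q`. -/
def MemLpOn {n : ℕ} (Ω : Set (Coord n)) (q : ℝ) (f : Coord n → ℝ) : Prop :=
  MemLp f (ENNReal.ofReal q) (volume.restrict Ω)

/-- `f ∈ L^q` on every compact subset of `Ω`. -/
def MemLpLocOn {n : ℕ} (Ω : Set (Coord n)) (q : ℝ) (f : Coord n → ℝ) : Prop :=
  ∀ K : Set (Coord n), IsCompact K → K ⊆ Ω → MemLpOn K q f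

/-- `g` is the weak partial derivative `∂f/∂xⁱ` on `Ω`
(used below for `f` and `g` in Lebesgue spaces of exponent greater than one). -/
def HasWeakPDeriv {n : ℕ} (Ω : Set (Coord n)) (i : Fin n) (f g : Coord n → ℝ) : Prop :=
  ∀ ψ : Coord n → ℝ, IsTestFunction Ω ψ →
    ∫ x in Ω, f x * pderiv i ψ x = -∫ x in Ω, g x * ψ x

/-- `f ∈ W^{1,p}(Ω)`, with weak partial derivatives `df i` in the directions `i`. -/
def MemW1p {n : ℕ} (Ω : Set (Coord n)) (p : ℝ) (f : Coord n → ℝ)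
    (df : Fin n → Coord n → ℝ) : Prop :=
  MemLpOn Ω p f ∧ ∀ i, MemLpOn Ω p (df i) ∧ HasWeakPDeriv Ω i f (df i)

/-- The components of a connection: `Γ μ ρ ν` is the function `Γ^μ_{ρν}`. -/
abbrev ConnectionComponents (n : ℕ) : Type := Fin n → Fin n → Fin n → Coord n → ℝ

/-- The components of a tensor of type `(1,3)`: `R τ μ ν ρ` is the function `R^τ_{μνρ}`. -/
abbrev CurvatureComponents (n : ℕ) : Type := Fin n → Fin n → Fin n → Fin n → Coord n → ℝ

/-- The quadratic part `(Γ ∧ Γ)^μ_{νρτ} = Γ^μ_{στ} Γ^σ_{νρ} - Γ^μ_{σρ} Γ^σ_{ντ}` of the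
curvature whose linear part is `∂_τ Γ^μ_{νρ} - ∂_ρ Γ^μ_{ντ}`. -/
def wedge {n : ℕ} (Γ : ConnectionComponents n) (μ ν ρ τ : Fin n) (x : Coord n) : ℝ :=
  ∑ σ, (Γ μ σ τ x * Γ σ ν ρ x - Γ μ σ ρ x * Γ σ ν τ x)

/-- The weak curvature `Riem(Γ)[ψ]^μ_{νρτ}` on `Ω`, as a functional of the test function `ψ`. -/
def weakRiem {n : ℕ} (Ω : Set (Coord n)) (Γ : ConnectionComponents n) (ψ : Coord n → ℝ)
    (μ ν ρ τ : Fin n) : ℝ :=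
  -(∫ x in Ω, (Γ μ ν ρ x * pderiv τ ψ x - Γ μ ν τ x * pderiv ρ ψ x))
    + ∫ x in Ω, wedge Γ μ ν ρ τ x * ψ x

/-- `Riem(Γ) = R` on `Ω` in the weak sense. -/
def HasWeakRiem {n : ℕ} (Ω : Set (Coord n)) (Γ : ConnectionComponents n)
    (R : CurvatureComponents n) : Prop :=
  ∀ ψ : Coord n → ℝ, IsTestFunction Ω ψ → ∀ μ ν ρ τ : Fin n,
    weakRiem Ω Γ ψ μ ν ρ τ = ∫ x in Ω, R μ ν ρ τ x * ψ x

/-- The open partial homeomorphism `y` is a `C¹` coordinate transformation from the open set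
`y.source` onto the open set `y.target`: it and its inverse are continuously differentiable. -/
def IsCoordTransformation {n : ℕ} (y : OpenPartialHomeomorph (Coord n) (Coord n)) : Prop :=
  ContDiffOn ℝ 1 y y.source ∧ ContDiffOn ℝ 1 y.symm y.target

/-- The Jacobian `J^α_μ = ∂y^α/∂x^μ` at `x`. -/
def jac {n : ℕ} (y : OpenPartialHomeomorph (Coord n) (Coord n)) (α μ : Fin n)
    (x : Coord n) : ℝ :=
  pderiv μ (fun z => y z α) x

/-- The inverse Jacobian `(J⁻¹)^μ_α = ∂x^μ/∂y^α`, as a function of `x`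
(that is, evaluated at the point `y(x)`). -/
def invJac {n : ℕ} (y : OpenPartialHomeomorph (Coord n) (Coord n)) (μ α : Fin n)
    (x : Coord n) : ℝ :=
  jac y.symm μ α (y x)

/-- The connection transformation law, almost everywhere on `y.source`:
`(Γ_x)^μ_{ρν} = ∂x^μ/∂y^α (∂y^β/∂x^ρ ∂y^γ/∂x^ν (Γ_y)^α_{βγ} + ∂/∂x^ρ (∂y^α/∂x^ν))`,
where `dJ α ν ρ` is the weak derivative `∂/∂x^ρ (∂y^α/∂x^ν)`. -/
def ConnectionLaw {n : ℕ} (y : OpenPartialHomeomorph (Coord n) (Coord n))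
    (dJ : Fin n → Fin n → Fin n → Coord n → ℝ) (Γx Γy : ConnectionComponents n) : Prop :=
  ∀ μ ρ ν : Fin n, ∀ᵐ x ∂(volume.restrict y.source),
    Γx μ ρ ν x = ∑ α, invJac y μ α x *
      ((∑ β, ∑ γ, jac y β ρ x * jac y γ ν x * Γy α β γ (y x)) + dJ α ν ρ x)

/-- The tensor transformation law, almost everywhere on `y.source`:
`(R_x)^τ_{μνρ} = ∂x^τ/∂y^δ ∂y^α/∂x^μ ∂y^β/∂x^ν ∂y^γ/∂x^ρ (R_y)^δ_{αβγ}`. -/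
def TensorLaw {n : ℕ} (y : OpenPartialHomeomorph (Coord n) (Coord n))
    (Rx Ry : CurvatureComponents n) : Prop :=
  ∀ τ μ ν ρ : Fin n, ∀ᵐ x ∂(volume.restrict y.source),
    Rx τ μ ν ρ x = ∑ δ, ∑ α, ∑ β, ∑ γ,
      invJac y τ δ x * jac y α μ x * jac y β ν x * jac y γ ρ x * Ry δ α β γ (y x)

/-- All the functions `f i j` are bounded on `Ω`. -/
def BoundedOn {n : ℕ} (Ω : Set (Coord n)) (f : Fin n → Fin n → Coord n → ℝ) : Prop :=
  ∃ M : ℝ, ∀ i j : Fin n, ∀ x ∈ Ω, |f i j x| ≤ M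

/-- The interior cone condition: every point of `Ω` is the vertex of an open spherical cone
contained in `Ω`, with height `h` and aperture (given by its cosine `c`) independent of the
point. Bounded domains with Lipschitz boundary satisfy it. -/
def ConeCondition {n : ℕ} (Ω : Set (Coord n)) : Prop :=
  ∃ h c : ℝ, 0 < h ∧ 0 < c ∧ c < 1 ∧ ∀ x ∈ Ω, ∃ v : Coord n, ‖v‖ = 1 ∧
    ∀ z : Coord n, ‖z - x‖ < h → c * ‖z - x‖ < inner ℝ v (z - x) → z ∈ Ω

end WeakCurvature

end

/-!
Fix the lower index `β` and the upper index `α` of a connection and read `Γ^α_{β ·}` as a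
`1`-form. The equation `Riem(Γ) = R` then says that this matrix of forms `Γ` has a weak exterior
derivative, or curl, given in `L¹_loc` by `R - Γ ∧ Γ` (`hasWeakRiem_iff`). The change of
coordinates is carried out in two moves.

* Gauge transformation on the source, without moving points. The form `B = (J Γ_x - dJ) J⁻¹` is
  the pullback of `Γ_y` by the connection law and the symmetry of second weak derivatives. Its curl
  follows from the product rule: `J` is continuous with weak derivatives in `L²_loc`, so the same is
  true of `J⁻¹`, with `d(J⁻¹) = -J⁻¹ dJ J⁻¹` (`hasWeakGrad_of_mul_eq_one`), and each product is one
  of a continuous function with gradient in `L²_loc` and a form in `L²_loc` with curl in `L¹_loc`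
  (`HasWeakCurl.mul_left`). The result is `J R_x J⁻¹ - B ∧ B` (`hasWeakCurl_gauge`).
* Pullback of a form with weak curl along the inverse transformation, which is only `C¹`
  (`HasWeakCurl.pullback`). The derivatives of the Jacobian cancel by antisymmetry, that is, because
  the curl of a gradient vanishes weakly (`hasWeakCurl_pderiv`). In the new coordinates this gives
  the weak curl `R_y - Γ_y ∧ Γ_y` of `Γ_y`.

Weak gradients and weak curls are both weak divergences of a vector field (`WeakDiv`), so the
product rules, the uniqueness of weak derivatives and the approximation by smooth functions need
to be proved once. The approximation is by mollification of a function cut off near a compact set;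
it converges in `L^q` on that set and, for continuous functions, uniformly.

The tensor law solved for `R_y` has continuous coefficients, so `R_y` is locally in `L^p`, and it is
globally in `L^p` if `J` and `J⁻¹` are bounded, which also bounds the determinant in the change of
variables. Under the cone condition boundedness follows from Morrey's estimate with `p > n`
(`ConeCondition.exists_abs_le`): the modulus of a function at a point is at most its average over a
ball inside a cone with that vertex, plus the averaged integrals of the gradient along the segments
to the vertex; Hölder's inequality on the rescaled ball costs a factor `t ^ (-n / p)`, which is
integrable on `(0, 1]`.
-/

open Set Filter Topology
open scoped ENNReal

noncomputable section

namespace WeakCurvature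

variable {n : ℕ}

/-! ### Mollification -/

/-- The smooth bump function at the origin with support in the ball of radius `1 / (k + 1)`. -/
def bump (n k : ℕ) : ContDiffBump (0 : Coord n) where
  rIn := 1 / ((k : ℝ) + 2)
  rOut := 1 / ((k : ℝ) + 1)
  rIn_pos := by positivity
  rIn_lt_rOut := by gcongr; norm_num

/-- The kernel of the `k`-th mollifier: a smooth probability density supported in the ball of
radius `1 / (k + 1)`. -/
def mollKernel (n k : ℕ) : Coord n → ℝ := (bump n k).normed volume

/-- The mollification of `f` at scale `1 / (k + 1)`. -/
def moll (k : ℕ) (f : Coord n → ℝ) : Coord n → ℝ :=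
  convolution (mollKernel n k) f (ContinuousLinearMap.lsmul ℝ ℝ) volume

theorem tendsto_bump_rOut (n : ℕ) : Tendsto (fun k => (bump n k).rOut) atTop (𝓝 0) :=
  tendsto_one_div_add_atTop_nhds_zero_nat

theorem contDiff_mollKernel (k : ℕ) : ContDiff ℝ ∞ (mollKernel n k) :=
  (bump n k).contDiff_normed

theorem hasCompactSupport_mollKernel (k : ℕ) : HasCompactSupport (mollKernel n k) :=
  (bump n k).hasCompactSupport_normed

theorem moll_apply (k : ℕ) (f : Coord n → ℝ) (x : Coord n) :
    moll k f x = ∫ t, mollKernel n k t * f (x - t) := rfl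

theorem moll_eq_flip (k : ℕ) (f : Coord n → ℝ) :
    moll k f = convolution f (mollKernel n k) (ContinuousLinearMap.lsmul ℝ ℝ) volume := by
  ext x
  rw [moll, convolution_eq_swap, convolution_def]
  simp [mul_comm]

theorem contDiff_moll (k : ℕ) {f : Coord n → ℝ} (hf : LocallyIntegrable f volume) :
    ContDiff ℝ ∞ (moll k f) :=
  (hasCompactSupport_mollKernel k).contDiff_convolution_left _ (contDiff_mollKernel k) hf

theorem pderiv_moll (k : ℕ) {f : Coord n → ℝ} (hf : LocallyIntegrable f volume) (i : Fin n)
    (x : Coord n) :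
    pderiv i (moll k f) x = ∫ t, f t * pderiv i (mollKernel n k) (x - t) := by
  have hs := contDiff_mollKernel (n := n) k
  have h := (hasCompactSupport_mollKernel k).hasFDerivAt_convolution_right
    (ContinuousLinearMap.lsmul ℝ ℝ) hf (hs.of_le (by norm_cast)) x
  rw [← moll_eq_flip] at h
  rw [pderiv, h.fderiv, convolution_precompR_apply _ hf ((hasCompactSupport_mollKernel k).fderiv ℝ)
    (hs.continuous_fderiv (by simp)), convolution_def]
  rfl

theorem moll_apply_eq_flip (k : ℕ) (f : Coord n → ℝ) (x : Coord n) :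
    moll k f x = ∫ t, f t * mollKernel n k (x - t) := by
  rw [moll_eq_flip, convolution_def]; rfl

/-- Mollification does not move a function by more than its oscillation at the mollifier's scale. -/
theorem abs_moll_sub_le (k : ℕ) {f : Coord n → ℝ} (hf : AEStronglyMeasurable f volume)
    {x : Coord n} {ε : ℝ} (h : ∀ z ∈ Metric.ball x (bump n k).rOut, |f z - f x| ≤ ε) :
    |moll k f x - f x| ≤ ε :=
  (bump n k).dist_normed_convolution_le hf h

/-- Translation is continuous in `L^q` for finite `q`. -/
theorem tendsto_eLpNorm_translate {f : Coord n → ℝ} {q : ℝ≥0∞} (hf : MemLp f q volume)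
    (h1 : 1 ≤ q) (hq : q ≠ ⊤) :
    Tendsto (fun t => eLpNorm (fun x => f (x - t) - f x) q volume) (𝓝 0) (𝓝 0) := by
  have : Fact (1 ≤ q) := ⟨h1⟩
  let g : Coord n → C(Coord n, Coord n) := fun t => ⟨fun x => x - t, by fun_prop⟩
  have hg : Continuous g := by
    apply ContinuousMap.continuous_of_continuous_uncurry
    change Continuous fun z : Coord n × Coord n => z.2 - z.1
    fun_prop
  have hgm : ∀ t, MeasurePreserving (g t) (volume : Measure (Coord n)) volume := fun t =>
    measurePreserving_sub_right volume t
  have hc : Continuous fun t => Lp.compMeasurePreserving (g t) (hgm t) (hf.toLp f) :=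
    continuous_const.compMeasurePreservingLp hg hgm hq
  have h0 := hc.tendsto 0
  have h2 := tendsto_iff_edist_tendsto_0.1 h0
  refine h2.congr fun t => ?_
  rw [Lp.edist_def]
  apply eLpNorm_congr_ae
  have e1 := Lp.coeFn_compMeasurePreserving (hf.toLp f) (hgm t)
  have e2 := Lp.coeFn_compMeasurePreserving (hf.toLp f) (hgm 0)
  have e3 := (hgm t).quasiMeasurePreserving.ae_eq_comp hf.coeFn_toLp
  have e4 := (hgm 0).quasiMeasurePreserving.ae_eq_comp hf.coeFn_toLp
  filter_upwards [e1, e2, e3, e4] with x h1 h2 h3 h4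
  simp only [Pi.sub_apply, h1, h2, h3, h4]
  simp [g]

/-- The mollification error is at most the largest translation error at the mollifier's scale, by
Jensen's inequality for the probability density `mollKernel n k`. -/
theorem eLpNorm_moll_sub_le (k : ℕ) {f : Coord n → ℝ} {q : ℝ≥0∞} (hf : MemLp f q volume)
    (h1 : 1 ≤ q) (hq : q ≠ ⊤) {ε : ℝ≥0∞}
    (h : ∀ t ∈ Metric.ball (0 : Coord n) (bump n k).rOut,
      eLpNorm (fun x => f (x - t) - f x) q volume ≤ ε) :
    eLpNorm (fun x => moll k f x - f x) q volume ≤ ε := by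
  have hloc := hf.locallyIntegrable h1
  set ρ : Coord n → ℝ≥0∞ := fun t => ENNReal.ofReal (mollKernel n k t) with hρ
  have hρc : Continuous (mollKernel n k) := (contDiff_mollKernel k).continuous
  have hρm : Measurable ρ := ENNReal.measurable_ofReal.comp hρc.measurable
  set ν : Measure (Coord n) := volume.withDensity ρ with hν
  have hnn : ∀ t, 0 ≤ mollKernel n k t := fun t => (bump n k).nonneg_normed t
  have hint : ∫ t, mollKernel n k t = 1 := (bump n k).integral_normed
  have hmi : Integrable (mollKernel n k) := (bump n k).integrable_normed
  have hone : ∫⁻ t, ρ t = 1 := by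
    rw [← ENNReal.ofReal_one, ← hint]
    exact (ofReal_integral_eq_lintegral_ofReal hmi (Eventually.of_forall hnn)).symm
  have : IsProbabilityMeasure ν := ⟨by rw [hν, withDensity_apply _ MeasurableSet.univ]; simpa⟩
  have hq0 : q ≠ 0 := (one_pos.trans_le h1).ne'
  set r := q.toReal with hr
  have hr1 : 1 ≤ r := by
    rw [hr, ← ENNReal.toReal_one]; exact ENNReal.toReal_mono hq h1
  have hr0 : 0 < r := by linarith
  have hmeas : AEStronglyMeasurable (fun z : Coord n × Coord n => f (z.1 - z.2) - f z.1)
      (volume.prod volume) :=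
    (hf.1.comp_quasiMeasurePreserving (quasiMeasurePreserving_sub_of_right_invariant _ _)).sub
      hf.1.comp_fst
  have hexist : ∀ x, Integrable (fun t => mollKernel n k t * f (x - t)) := fun x =>
    (hasCompactSupport_mollKernel k).convolutionExists_left (ContinuousLinearMap.lsmul ℝ ℝ)
      hρc hloc x
  have hslice : ∀ x, AEStronglyMeasurable (fun t => f (x - t) - f x) (volume : Measure (Coord n)) :=
    fun x => (hf.1.comp_quasiMeasurePreserving
      (quasiMeasurePreserving_sub_left volume x)).sub aestronglyMeasurable_const
  have hpt : ∀ x, ‖moll k f x - f x‖ₑ ^ r ≤ ∫⁻ t, ρ t * ‖f (x - t) - f x‖ₑ ^ r := by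
    intro x
    have e1 : moll k f x - f x = ∫ t, mollKernel n k t * (f (x - t) - f x) := by
      have : f x = ∫ t, mollKernel n k t * f x := by
        rw [integral_mul_const, hint, one_mul]
      rw [moll_apply]
      conv_lhs => rw [this]
      rw [← integral_sub (hexist x) (hmi.mul_const _)]
      simp_rw [mul_sub]
    have e2 : ‖moll k f x - f x‖ₑ ≤ ∫⁻ t, ‖f (x - t) - f x‖ₑ ∂ν := by
      rw [e1, hν, lintegral_withDensity_eq_lintegral_mul₀ hρm.aemeasurable (hslice x).enorm]
      refine (enorm_integral_le_lintegral_enorm _).trans (le_of_eq ?_)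
      congr 1; ext t
      rw [enorm_mul, Pi.mul_apply, Real.enorm_of_nonneg (hnn t)]
    have hac : ν ≪ volume := withDensity_absolutelyContinuous _ _
    have e3 := eLpNorm_le_eLpNorm_of_exponent_le (μ := ν) h1 ((hslice x).mono_ac hac)
    rw [eLpNorm_one_eq_lintegral_enorm, eLpNorm_eq_lintegral_rpow_enorm_toReal hq0 hq] at e3
    calc ‖moll k f x - f x‖ₑ ^ r ≤ ((∫⁻ t, ‖f (x - t) - f x‖ₑ ^ r ∂ν) ^ (1 / r)) ^ r := by
          gcongr; exact e2.trans e3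
      _ = ∫⁻ t, ‖f (x - t) - f x‖ₑ ^ r ∂ν := by
          rw [← ENNReal.rpow_mul, one_div_mul_cancel hr0.ne', ENNReal.rpow_one]
      _ = _ := by
          rw [hν, lintegral_withDensity_eq_lintegral_mul₀ hρm.aemeasurable
            ((hslice x).enorm.pow_const r)]
          rfl
  have hball : ∀ t, ρ t * ∫⁻ x, ‖f (x - t) - f x‖ₑ ^ r ≤ ρ t * ε ^ r := by
    intro t
    by_cases ht : t ∈ Metric.ball (0 : Coord n) (bump n k).rOut
    · gcongr
      have := h t ht
      rw [eLpNorm_eq_lintegral_rpow_enorm_toReal hq0 hq] at this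
      have h3 := ENNReal.rpow_le_rpow this hr0.le
      rwa [← ENNReal.rpow_mul, one_div_mul_cancel hr0.ne', ENNReal.rpow_one] at h3
    · have : mollKernel n k t = 0 := by
        have h4 := (bump n k).support_normed_eq (μ := volume)
        by_contra h5
        exact ht (h4 ▸ h5)
      simp [hρ, this]
  have hfin : ∫⁻ x, ‖moll k f x - f x‖ₑ ^ r ≤ ε ^ r := by
    calc ∫⁻ x, ‖moll k f x - f x‖ₑ ^ r ≤ ∫⁻ x, ∫⁻ t, ρ t * ‖f (x - t) - f x‖ₑ ^ r :=
          lintegral_mono hpt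
      _ = ∫⁻ t, ∫⁻ x, ρ t * ‖f (x - t) - f x‖ₑ ^ r := by
          apply lintegral_lintegral_swap
          exact (hρm.comp measurable_snd).aemeasurable.mul (hmeas.enorm.pow_const r)
      _ = ∫⁻ t, ρ t * ∫⁻ x, ‖f (x - t) - f x‖ₑ ^ r := by
          congr 1; ext t
          rw [lintegral_const_mul' _ _ (by simp [hρ])]
      _ ≤ ∫⁻ t, ρ t * ε ^ r := lintegral_mono hball
      _ = ε ^ r := by rw [lintegral_mul_const _ hρm, hone, one_mul]
  rw [eLpNorm_eq_lintegral_rpow_enorm_toReal hq0 hq]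
  calc _ ≤ (ε ^ r) ^ (1 / r) := by gcongr
    _ = ε := by rw [← ENNReal.rpow_mul, mul_one_div_cancel hr0.ne', ENNReal.rpow_one]

/-- Mollifications converge in `L^q`, `1 ≤ q < ∞`. -/
theorem tendsto_eLpNorm_moll {f : Coord n → ℝ} {q : ℝ≥0∞} (hf : MemLp f q volume)
    (h1 : 1 ≤ q) (hq : q ≠ ⊤) :
    Tendsto (fun k => eLpNorm (fun x => moll k f x - f x) q volume) atTop (𝓝 0) := by
  rw [ENNReal.tendsto_nhds_zero]
  intro ε hε
  have h := (ENNReal.tendsto_nhds_zero.1 (tendsto_eLpNorm_translate hf h1 hq)) ε hε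
  obtain ⟨δ, hδ, hb⟩ := Metric.eventually_nhds_iff_ball.1 h
  filter_upwards [(tendsto_bump_rOut n).eventually (gt_mem_nhds hδ)] with k hk
  exact eLpNorm_moll_sub_le k hf h1 hq fun t ht => hb t (Metric.ball_subset_ball hk.le ht)

/-! ### Local Lebesgue spaces and test functions -/

/-- `f ∈ L^q_loc(Ω)`, with an extended exponent `q`; in particular `q = ⊤` says that `f` is
essentially bounded on every compact subset of `Ω`. -/
def LocLp (Ω : Set (Coord n)) (q : ℝ≥0∞) (f : Coord n → ℝ) : Prop :=
  ∀ K : Set (Coord n), IsCompact K → K ⊆ Ω → MemLp f q (volume.restrict K)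

section LocLp

variable {Ω : Set (Coord n)} {q q₁ q₂ : ℝ≥0∞} {f g : Coord n → ℝ}

theorem _root_.ContinuousOn.locLp_top (hf : ContinuousOn f Ω) : LocLp Ω ⊤ f := by
  intro K hK hKΩ
  have hc := hf.mono hKΩ
  obtain ⟨C, hC⟩ := hK.exists_bound_of_continuousOn hc
  exact memLp_top_of_bound (hc.aestronglyMeasurable hK.measurableSet) C
    ((ae_restrict_iff' hK.measurableSet).2 (Eventually.of_forall hC))

theorem LocLp.mono_exponent (hf : LocLp Ω q f) (h : q₁ ≤ q) : LocLp Ω q₁ f := by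
  intro K hK hKΩ
  have : IsFiniteMeasure (volume.restrict K) := ⟨by simpa using hK.measure_lt_top⟩
  exact (hf K hK hKΩ).mono_exponent h

theorem LocLp.mul (hf : LocLp Ω q₁ f) (hg : LocLp Ω q₂ g) [ENNReal.HolderTriple q₁ q₂ q] :
    LocLp Ω q fun x => f x * g x :=
  fun K hK h => (hg K hK h).mul' (hf K hK h)

theorem LocLp.add (hf : LocLp Ω q f) (hg : LocLp Ω q g) : LocLp Ω q fun x => f x + g x :=
  fun K hK h => (hf K hK h).add (hg K hK h)

theorem LocLp.sub (hf : LocLp Ω q f) (hg : LocLp Ω q g) : LocLp Ω q fun x => f x - g x :=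
  fun K hK h => (hf K hK h).sub (hg K hK h)

theorem LocLp.sum {ι : Type*} {s : Finset ι} {f : ι → Coord n → ℝ}
    (hf : ∀ i ∈ s, LocLp Ω q (f i)) : LocLp Ω q fun x => ∑ i ∈ s, f i x :=
  fun K hK h => memLp_finsetSum s fun i hi => hf i hi K hK h

theorem LocLp.neg (hf : LocLp Ω q f) : LocLp Ω q fun x => -f x :=
  fun K hK h => (hf K hK h).neg

theorem locLp_zero : LocLp Ω q fun _ => 0 := fun _ _ _ => MemLp.zero'

theorem LocLp.congr (hf : LocLp Ω q f) (h : ∀ᵐ x ∂volume.restrict Ω, f x = g x) : LocLp Ω q g :=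
  fun K hK hKΩ => (hf K hK hKΩ).ae_eq (ae_mono (Measure.restrict_mono hKΩ le_rfl) h)

theorem MemLpOn.locLp {r : ℝ} (hf : MemLpOn Ω r f) : LocLp Ω (ENNReal.ofReal r) f :=
  fun _ _ hKΩ => hf.mono_measure (Measure.restrict_mono hKΩ le_rfl)

theorem LocLp.integrable_mul (hf : LocLp Ω 1 f) (hg : Continuous g) (hgc : HasCompactSupport g)
    (hgΩ : tsupport g ⊆ Ω) : Integrable fun x => f x * g x := by
  have hS : IsCompact (tsupport g) := hgc
  have h1 : Integrable ((tsupport g).indicator f) :=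
    (integrable_indicator_iff hS.measurableSet).2 (memLp_one_iff_integrable.1 (hf _ hS hgΩ))
  obtain ⟨C, hC⟩ := hg.bounded_above_of_compact_support hgc
  refine (h1.mul_bdd hg.aestronglyMeasurable (Eventually.of_forall hC)).congr
    (Eventually.of_forall fun x => ?_)
  by_cases hx : x ∈ tsupport g
  · simp [hx]
  · simp [image_eq_zero_of_notMem_tsupport hx]

end LocLp

theorem pderiv_eq_zero_of_notMem_tsupport {ψ : Coord n → ℝ} {x : Coord n} (i : Fin n)
    (hx : x ∉ tsupport ψ) : pderiv i ψ x = 0 := by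
  have h : fderiv ℝ ψ x = 0 := by
    by_contra h
    exact hx (support_fderiv_subset ℝ h)
  simp [pderiv, h]

theorem tsupport_pderiv_subset (ψ : Coord n → ℝ) (i : Fin n) :
    tsupport (pderiv i ψ) ⊆ tsupport ψ :=
  closure_minimal (fun x hx => by
    by_contra h
    exact hx (pderiv_eq_zero_of_notMem_tsupport i h)) (isClosed_tsupport _)

theorem contDiff_pderiv {ψ : Coord n → ℝ} (h : ContDiff ℝ ∞ ψ) (i : Fin n) :
    ContDiff ℝ ∞ (pderiv i ψ) :=
  (h.fderiv_right (m := ∞) (by norm_cast)).clm_apply contDiff_const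

section TestFunction

variable {Ω : Set (Coord n)} {ψ : Coord n → ℝ}

theorem IsTestFunction.pderiv (h : IsTestFunction Ω ψ) (i : Fin n) :
    IsTestFunction Ω (pderiv i ψ) :=
  ⟨contDiff_pderiv h.1 i, h.2.1.mono' ((subset_tsupport _).trans (tsupport_pderiv_subset ψ i)),
    (tsupport_pderiv_subset ψ i).trans h.2.2⟩

theorem IsTestFunction.mul_left (h : IsTestFunction Ω ψ) {u : Coord n → ℝ} (hu : ContDiff ℝ ∞ u) :
    IsTestFunction Ω fun x => u x * ψ x :=
  ⟨hu.mul h.1, h.2.1.mul_left, (tsupport_mul_subset_right).trans h.2.2⟩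

theorem LocLp.integrable_mul_test {f : Coord n → ℝ} (hf : LocLp Ω 1 f)
    (h : IsTestFunction Ω ψ) : Integrable fun x => f x * ψ x :=
  hf.integrable_mul h.1.continuous h.2.1 h.2.2

theorem pderiv_mul {u v : Coord n → ℝ} {x : Coord n} (hu : DifferentiableAt ℝ u x)
    (hv : DifferentiableAt ℝ v x) (i : Fin n) :
    WeakCurvature.pderiv i (fun z => u z * v z) x
      = u x * WeakCurvature.pderiv i v x + v x * WeakCurvature.pderiv i u x := by
  simp [WeakCurvature.pderiv, fderiv_fun_mul hu hv]

end TestFunction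

/-! ### Weak divergences -/

/-- The locally integrable vector field `V` has weak divergence `G ∈ L^1_loc(Ω)`. A weak partial
derivative of `u` is the weak divergence of a field with the single component `u`, and a weak
curl of a one-form is a family of weak divergences. -/
structure WeakDiv (Ω : Set (Coord n)) (V : Fin n → Coord n → ℝ) (G : Coord n → ℝ) : Prop where
  locV : ∀ i, LocLp Ω 1 (V i)
  locG : LocLp Ω 1 G
  integral_eq : ∀ ψ, IsTestFunction Ω ψ → ∫ x, ((∑ i, V i x * pderiv i ψ x) + G x * ψ x) = 0

section WeakDiv

variable {Ω : Set (Coord n)} {V W : Fin n → Coord n → ℝ} {G H : Coord n → ℝ}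

theorem integrable_weakDiv_integrand (hV : ∀ i, LocLp Ω 1 (V i)) (hG : LocLp Ω 1 G)
    {ψ : Coord n → ℝ} (hψ : IsTestFunction Ω ψ) :
    Integrable fun x => (∑ i, V i x * pderiv i ψ x) + G x * ψ x :=
  (integrable_finsetSum _ fun i _ => (hV i).integrable_mul_test (hψ.pderiv i)).add
    (hG.integrable_mul_test hψ)

theorem WeakDiv.add (h : WeakDiv Ω V G) (h' : WeakDiv Ω W H) :
    WeakDiv Ω (fun i x => V i x + W i x) (fun x => G x + H x) where
  locV i := (h.locV i).add (h'.locV i)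
  locG := h.locG.add h'.locG
  integral_eq ψ hψ := by
    have e := congrArg₂ (· + ·) (h.integral_eq ψ hψ) (h'.integral_eq ψ hψ)
    simp only [add_zero] at e
    rw [← integral_add (integrable_weakDiv_integrand h.locV h.locG hψ)
      (integrable_weakDiv_integrand h'.locV h'.locG hψ)] at e
    rw [← e]
    congr 1; ext x
    simp only [add_mul, Finset.sum_add_distrib]
    ring

theorem WeakDiv.neg (h : WeakDiv Ω V G) : WeakDiv Ω (fun i x => -V i x) (fun x => -G x) where
  locV i := (h.locV i).neg
  locG := h.locG.neg
  integral_eq ψ hψ := by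
    have e := h.integral_eq ψ hψ
    rw [← neg_eq_zero, ← integral_neg] at e
    rw [← e]
    congr 1; ext x
    simp only [neg_mul, Finset.sum_neg_distrib]
    ring

theorem WeakDiv.sub (h : WeakDiv Ω V G) (h' : WeakDiv Ω W H) :
    WeakDiv Ω (fun i x => V i x - W i x) (fun x => G x - H x) := by
  simpa only [sub_eq_add_neg] using h.add h'.neg

theorem weakDiv_zero : WeakDiv Ω (fun _ _ => 0) (fun _ => 0) where
  locV _ := locLp_zero
  locG := locLp_zero
  integral_eq ψ hψ := by simp

theorem WeakDiv.sum {ι : Type*} (s : Finset ι) {V : ι → Fin n → Coord n → ℝ}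
    {G : ι → Coord n → ℝ} (h : ∀ a, WeakDiv Ω (V a) (G a)) :
    WeakDiv Ω (fun i x => ∑ a ∈ s, V a i x) (fun x => ∑ a ∈ s, G a x) := by
  classical
  induction s using Finset.induction_on with
  | empty => simpa using weakDiv_zero
  | insert a s ha ih => simpa only [Finset.sum_insert ha] using (h a).add ih

theorem WeakDiv.congr (h : WeakDiv Ω V G) (hV : ∀ i, ∀ᵐ x ∂volume.restrict Ω, V i x = W i x)
    (hG : ∀ᵐ x ∂volume.restrict Ω, G x = H x) : WeakDiv Ω W H where
  locV i := (h.locV i).congr (hV i)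
  locG := h.locG.congr hG
  integral_eq ψ hψ := by
    have hz : ∀ (V : Fin n → Coord n → ℝ) (G : Coord n → ℝ), ∀ x ∉ Ω,
        (∑ i, V i x * pderiv i ψ x) + G x * ψ x = 0 := by
      intro V G x hx
      have hx' : x ∉ tsupport ψ := fun h => hx (hψ.2.2 h)
      simp [pderiv_eq_zero_of_notMem_tsupport _ hx', image_eq_zero_of_notMem_tsupport hx']
    rw [← h.integral_eq ψ hψ, ← setIntegral_eq_integral_of_forall_compl_eq_zero (hz W H),
      ← setIntegral_eq_integral_of_forall_compl_eq_zero (hz V G)]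
    apply integral_congr_ae
    filter_upwards [ae_all_iff.2 hV, hG] with x h1 h2
    simp only [h1, h2]

end WeakDiv

/-! ### Local smooth approximation -/

theorem tendsto_eLpNorm_top_of_bound {S : Set (Coord n)} (hS : MeasurableSet S)
    {F : ℕ → Coord n → ℝ} {f : Coord n → ℝ}
    (h : ∀ ε > 0, ∀ᶠ k in atTop, ∀ x ∈ S, |F k x - f x| ≤ ε) :
    Tendsto (fun k => eLpNorm (fun x => F k x - f x) ⊤ (volume.restrict S)) atTop (𝓝 0) := by
  rw [ENNReal.tendsto_nhds_zero]
  intro ε hε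
  obtain ⟨δ, hδ, hδε⟩ := ENNReal.lt_iff_exists_real_btwn.1 hε
  filter_upwards [h δ (ENNReal.ofReal_pos.1 hδε.1)] with k hk
  refine le_trans ?_ hδε.2.le
  rw [eLpNorm_exponent_top]
  apply eLpNormEssSup_le_of_ae_bound
  filter_upwards [ae_restrict_mem hS] with x hx using hk x hx

/-- Smooth approximations of a function on the interior of a compact set `T`: mollifications of
the restriction of `f` to `T`. -/
def approx (T : Set (Coord n)) (k : ℕ) (f : Coord n → ℝ) : Coord n → ℝ :=
  moll k (T.indicator f)

/-- `T` is a compact subset of `Ω` that contains, for large `k`, the supports of the `k`-th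
mollifiers centred at the points of `S`. -/
structure IsCollar (S T Ω : Set (Coord n)) : Prop where
  isCompact : IsCompact T
  subset : T ⊆ Ω
  inner_subset : S ⊆ T
  ball_subset : ∀ᶠ k in atTop, ∀ x ∈ S, Metric.closedBall x (bump n k).rOut ⊆ T

theorem exists_isCollar {S Ω : Set (Coord n)} (hS : IsCompact S) (hΩ : IsOpen Ω) (h : S ⊆ Ω) :
    ∃ T, IsCollar S T Ω := by
  obtain ⟨δ, hδ, hsub⟩ := hS.exists_cthickening_subset_open hΩ h
  refine ⟨Metric.cthickening δ S, hS.cthickening, hsub, Metric.self_subset_cthickening S, ?_⟩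
  filter_upwards [(tendsto_bump_rOut n).eventually (gt_mem_nhds hδ)] with k hk x hx
  exact (Metric.closedBall_subset_closedBall hk.le).trans
    (Metric.closedBall_subset_cthickening hx δ)

section approx

variable {S T Ω : Set (Coord n)} {f : Coord n → ℝ}

theorem IsCollar.memLp_indicator (h : IsCollar S T Ω) {q : ℝ≥0∞} (hf : LocLp Ω q f) :
    MemLp (T.indicator f) q volume :=
  (memLp_indicator_iff_restrict h.isCompact.measurableSet).2 (hf T h.isCompact h.subset)

theorem IsCollar.locallyIntegrable_indicator (h : IsCollar S T Ω) (hf : LocLp Ω 1 f) :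
    LocallyIntegrable (T.indicator f) volume :=
  (h.memLp_indicator hf).locallyIntegrable le_rfl

theorem IsCollar.contDiff_approx (h : IsCollar S T Ω) (hf : LocLp Ω 1 f) (k : ℕ) :
    ContDiff ℝ ∞ (approx T k f) :=
  contDiff_moll k (h.locallyIntegrable_indicator hf)

theorem IsCollar.tendsto_approx (h : IsCollar S T Ω) (hS : MeasurableSet S) {q : ℝ≥0∞}
    (h1 : 1 ≤ q) (hq : q ≠ ⊤) (hf : LocLp Ω q f) :
    Tendsto (fun k => eLpNorm (fun x => approx T k f x - f x) q (volume.restrict S))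
      atTop (𝓝 0) := by
  refine tendsto_of_tendsto_of_tendsto_of_le_of_le tendsto_const_nhds
    (tendsto_eLpNorm_moll (h.memLp_indicator hf) h1 hq) (fun _ => zero_le) fun k => ?_
  calc _ = eLpNorm (fun x => moll k (T.indicator f) x - T.indicator f x) q
        (volume.restrict S) := by
        apply eLpNorm_congr_ae
        filter_upwards [ae_restrict_mem hS] with x hx
        rw [approx, indicator_of_mem (h.inner_subset hx)]
    _ ≤ _ := eLpNorm_mono_measure _ Measure.restrict_le_self

theorem IsCollar.eventually_abs_approx_sub_le (h : IsCollar S T Ω) (hf : ContinuousOn f Ω)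
    {ε : ℝ} (hε : 0 < ε) : ∀ᶠ k in atTop, ∀ x ∈ S, |approx T k f x - f x| ≤ ε := by
  have hu := h.isCompact.uniformContinuousOn_of_continuous (hf.mono h.subset)
  obtain ⟨δ, hδ, hd⟩ := Metric.uniformContinuousOn_iff.1 hu ε hε
  filter_upwards [h.ball_subset, (tendsto_bump_rOut n).eventually (gt_mem_nhds hδ)] with k hk hkδ
    x hx
  have hxT := h.inner_subset hx
  have := abs_moll_sub_le k (f := T.indicator f) (x := x) (ε := ε)
    (h.memLp_indicator hf.locLp_top).1 (fun z hz => by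
      have hzT := hk x hx (Metric.ball_subset_closedBall hz)
      rw [indicator_of_mem hzT, indicator_of_mem hxT]
      exact (hd z hzT x hxT (lt_trans hz hkδ)).le)
  rwa [indicator_of_mem hxT] at this

theorem IsCollar.tendsto_approx_top (h : IsCollar S T Ω) (hS : MeasurableSet S)
    (hf : ContinuousOn f Ω) :
    Tendsto (fun k => eLpNorm (fun x => approx T k f x - f x) ⊤ (volume.restrict S))
      atTop (𝓝 0) :=
  tendsto_eLpNorm_top_of_bound hS fun _ hε => h.eventually_abs_approx_sub_le hf hε

/-- Mollification commutes with the weak divergence, away from the boundary. -/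
theorem WeakDiv.sum_pderiv_approx {V : Fin n → Coord n → ℝ} {G : Coord n → ℝ}
    (hV : WeakDiv Ω V G) (h : IsCollar S T Ω) {k : ℕ} {x : Coord n}
    (hx : Metric.closedBall x (bump n k).rOut ⊆ T) :
    ∑ i, pderiv i (approx T k (V i)) x = approx T k G x := by
  set ψ : Coord n → ℝ := fun t => mollKernel n k (x - t) with hψdef
  have hsm : ContDiff ℝ ∞ ψ := (contDiff_mollKernel k).comp (contDiff_const.sub contDiff_id)
  have hsupp : tsupport ψ ⊆ Metric.closedBall x (bump n k).rOut := by
    refine closure_minimal (fun t ht => ?_) Metric.isClosed_closedBall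
    have : x - t ∈ Function.support ((bump n k).normed volume) := ht
    rw [(bump n k).support_normed_eq, mem_ball_zero_iff] at this
    rw [Metric.mem_closedBall, dist_eq_norm, norm_sub_rev]
    exact this.le
  have hψ : IsTestFunction Ω ψ :=
    ⟨hsm, HasCompactSupport.of_support_subset_isCompact (isCompact_closedBall x (bump n k).rOut)
      ((subset_tsupport ψ).trans hsupp), hsupp.trans (hx.trans h.subset)⟩
  have hψ' : IsTestFunction univ ψ := ⟨hψ.1, hψ.2.1, subset_univ _⟩
  have hpd : ∀ i t, pderiv i ψ t = -pderiv i (mollKernel n k) (x - t) := by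
    intro i t
    have h1 : HasFDerivAt (fun t : Coord n => x - t) (-ContinuousLinearMap.id ℝ (Coord n)) t := by
      simpa using (hasFDerivAt_id t).const_sub x
    have h2 := ((contDiff_mollKernel (n := n) k).differentiable (by simp) (x - t)).hasFDerivAt
    have h3 : HasFDerivAt ψ _ t := h2.comp t h1
    simp [pderiv, h3.fderiv]
  have hloc : ∀ {f : Coord n → ℝ}, LocLp Ω 1 f → LocLp univ 1 (T.indicator f) := fun hf K _ _ =>
    (h.memLp_indicator hf).mono_measure Measure.restrict_le_self
  have e := hV.integral_eq ψ hψ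
  have e2 : ∀ t, (∑ i, V i t * pderiv i ψ t) + G t * ψ t
      = (∑ i, T.indicator (V i) t * pderiv i ψ t) + T.indicator G t * ψ t := by
    intro t
    by_cases ht : t ∈ T
    · simp [ht]
    · have : t ∉ tsupport ψ := fun h' => ht (hx (hsupp h'))
      simp [pderiv_eq_zero_of_notMem_tsupport _ this, image_eq_zero_of_notMem_tsupport this]
  simp_rw [e2] at e
  rw [integral_add (integrable_finsetSum _ fun i _ =>
      (hloc (hV.locV i)).integrable_mul_test (hψ'.pderiv i))
      ((hloc hV.locG).integrable_mul_test hψ'),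
    integral_finsetSum _ fun i _ => (hloc (hV.locV i)).integrable_mul_test (hψ'.pderiv i)] at e
  simp only [hpd, mul_neg, integral_neg, Finset.sum_neg_distrib] at e
  simp_rw [approx, pderiv_moll k (h.locallyIntegrable_indicator (hV.locV _)), moll_apply_eq_flip]
  linarith

end approx

theorem tendsto_eLpNorm_sub_self (f : Coord n → ℝ) (q : ℝ≥0∞) (μ : Measure (Coord n)) :
    Tendsto (fun _ : ℕ => eLpNorm (fun x => f x - f x) q μ) atTop (𝓝 0) := by
  simp only [sub_self, eLpNorm_zero']
  exact tendsto_const_nhds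

/-- A product of sequences converging in `L^{q₁}` and `L^{q₂}` with conjugate exponents has
convergent integrals. -/
theorem tendsto_integral_mul {μ : Measure (Coord n)} {q₁ q₂ : ℝ≥0∞}
    [ENNReal.HolderTriple q₁ q₂ 1] {F H : ℕ → Coord n → ℝ} {f h : Coord n → ℝ}
    (hF : ∀ᶠ k in atTop, MemLp (F k) q₁ μ) (hf : MemLp f q₁ μ)
    (hH : ∀ᶠ k in atTop, MemLp (H k) q₂ μ) (hh : MemLp h q₂ μ)
    (hFf : Tendsto (fun k => eLpNorm (fun x => F k x - f x) q₁ μ) atTop (𝓝 0))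
    (hHh : Tendsto (fun k => eLpNorm (fun x => H k x - h x) q₂ μ) atTop (𝓝 0)) :
    Tendsto (fun k => ∫ x, F k x * H k x ∂μ) atTop (𝓝 (∫ x, f x * h x ∂μ)) := by
  have hmul : ∀ {a b : Coord n → ℝ}, MemLp a q₁ μ → MemLp b q₂ μ →
      eLpNorm (fun x => a x * b x) 1 μ ≤ eLpNorm a q₁ μ * eLpNorm b q₂ μ := fun ha hb =>
    eLpNorm_smul_le_mul_eLpNorm (p := q₁) (q := q₂) (r := 1) (𝕜 := ℝ) hb.1 ha.1
  refine tendsto_integral_of_L1' _ ((hh.mul' hf (r := 1)).1)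
    (by filter_upwards [hF, hH] with k hk hk' using memLp_one_iff_integrable.1 (hk'.mul' hk)) ?_
  have hlim : Tendsto (fun k => eLpNorm (fun x => F k x - f x) q₁ μ *
        eLpNorm (fun x => H k x - h x) q₂ μ + (eLpNorm (fun x => F k x - f x) q₁ μ * eLpNorm h q₂ μ
        + eLpNorm f q₁ μ * eLpNorm (fun x => H k x - h x) q₂ μ)) atTop (𝓝 0) := by
    have h1 := ENNReal.Tendsto.mul hFf (Or.inr ENNReal.zero_ne_top) hHh
      (Or.inr ENNReal.zero_ne_top)
    have h2 := ENNReal.Tendsto.mul_const hFf (Or.inr hh.2.ne)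
    have h3 := ENNReal.Tendsto.const_mul hHh (Or.inr hf.2.ne)
    simpa using h1.add (h2.add h3)
  refine tendsto_of_tendsto_of_tendsto_of_le_of_le' tendsto_const_nhds hlim
    (Eventually.of_forall fun _ => zero_le) ?_
  filter_upwards [hF, hH] with k hFk hHk
  have e : (fun x => F k x * H k x) - (fun x => f x * h x)
      = (fun x => (F k x - f x) * (H k x - h x))
        + ((fun x => (F k x - f x) * h x) + fun x => f x * (H k x - h x)) := by
    ext x; simp only [Pi.sub_apply, Pi.add_apply]; ring
  have m1 := hFk.sub hf
  have m2 := hHk.sub hh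
  rw [e]
  have m3 : MemLp (fun x => (F k x - f x) * h x) 1 μ := hh.mul' m1
  have m4 : MemLp (fun x => f x * (H k x - h x)) 1 μ := m2.mul' hf
  have m5 : MemLp (fun x => (F k x - f x) * (H k x - h x)) 1 μ := m2.mul' m1
  exact (eLpNorm_add_le m5.1 (m3.1.add m4.1) le_rfl).trans (add_le_add (hmul m1 m2)
    ((eLpNorm_add_le m3.1 m4.1 le_rfl).trans (add_le_add (hmul m1 hh) (hmul hf m2))))

/-! ### Weak gradients and weak curls -/

/-- The vector field with the single component `u` in the direction `i`. -/
def singleField (i : Fin n) (u : Coord n → ℝ) : Fin n → Coord n → ℝ :=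
  fun k x => if k = i then u x else 0

/-- The vector field whose divergence is the component `∂_j a_i - ∂_i a_j` of the curl of the
one-form `a`. -/
def curlField (a : Fin n → Coord n → ℝ) (i j : Fin n) : Fin n → Coord n → ℝ :=
  fun k x => singleField j (a i) k x - singleField i (a j) k x

/-- `du` is the weak gradient of `u` on `Ω`. -/
def HasWeakGrad (Ω : Set (Coord n)) (u : Coord n → ℝ) (du : Fin n → Coord n → ℝ) : Prop :=
  ∀ i, WeakDiv Ω (singleField i u) (du i)

/-- The one-form `a` has the weak curl `∂_j a_i - ∂_i a_j = F i j` on `Ω`. -/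
def HasWeakCurl (Ω : Set (Coord n)) (a : Fin n → Coord n → ℝ)
    (F : Fin n → Fin n → Coord n → ℝ) : Prop :=
  ∀ i j, WeakDiv Ω (curlField a i j) (F i j)

theorem singleField_same (i : Fin n) (u : Coord n → ℝ) : singleField i u i = u := by
  ext x; simp [singleField]

theorem singleField_of_ne {i k : Fin n} (u : Coord n → ℝ) (h : k ≠ i) :
    singleField i u k = fun _ => 0 := by
  ext x; simp [singleField, h]

theorem sum_singleField_mul (i : Fin n) (u : Coord n → ℝ) (x : Coord n) (b : Fin n → ℝ) :
    ∑ k, singleField i u k x * b k = u x * b i := by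
  simp [singleField, ite_mul]

theorem sum_curlField_mul (a : Fin n → Coord n → ℝ) (i j : Fin n) (x : Coord n) (b : Fin n → ℝ) :
    ∑ k, curlField a i j k x * b k = a i x * b j - a j x * b i := by
  simp only [curlField, sub_mul, Finset.sum_sub_distrib, sum_singleField_mul]

section

variable {Ω : Set (Coord n)} {q : ℝ≥0∞} {u v : Coord n → ℝ} {du dv : Fin n → Coord n → ℝ}

theorem LocLp.singleField (hu : LocLp Ω q u) (i k : Fin n) :
    LocLp Ω q (singleField i u k) := by
  by_cases h : k = i
  · rwa [h, singleField_same]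
  · rw [singleField_of_ne u h]
    exact locLp_zero

theorem locLp_curlField {a : Fin n → Coord n → ℝ} (ha : ∀ i, LocLp Ω q (a i)) (i j k : Fin n) :
    LocLp Ω q (curlField a i j k) :=
  ((ha i).singleField j k).sub ((ha j).singleField i k)

theorem continuousOn_pderiv (hΩ : IsOpen Ω) (hu : ContDiffOn ℝ 1 u Ω) (i : Fin n) :
    ContinuousOn (pderiv i u) Ω :=
  (hu.continuousOn_fderiv_of_isOpen hΩ le_rfl).clm_apply continuousOn_const

theorem _root_.ContinuousOn.locLp_one (hu : ContinuousOn u Ω) : LocLp Ω 1 u :=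
  hu.locLp_top.mono_exponent le_top

/-- The classical gradient of a `C¹` function is its weak gradient. -/
theorem hasWeakGrad_of_contDiffOn (hΩ : IsOpen Ω) (hu : ContDiffOn ℝ 1 u Ω) :
    HasWeakGrad Ω u (fun i => pderiv i u) := by
  intro i
  have h1 := hu.continuousOn.locLp_one
  have h2 := (continuousOn_pderiv hΩ hu i).locLp_one
  refine ⟨fun k => h1.singleField i k, h2, fun ψ hψ => ?_⟩
  simp_rw [sum_singleField_mul i u _ fun k => pderiv k ψ _]
  have i1 := h1.integrable_mul_test (hψ.pderiv i)
  have i2 := h2.integrable_mul_test hψ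
  rw [integral_add i1 i2]
  have := integral_mul_fderiv_eq_neg_fderiv_mul_of_integrable (μ := volume) (f := u) (g := ψ)
    (v := EuclideanSpace.single i (1 : ℝ)) i2 i1 (h1.integrable_mul_test hψ)
    (fun x hx => (hu.differentiableOn one_ne_zero).differentiableAt (hΩ.mem_nhds (hψ.2.2 hx)))
    (fun x _ => hψ.1.differentiable (by simp) x)
  exact add_eq_zero_iff_eq_neg.2 this

theorem pderiv_comm {ψ : Coord n → ℝ} (hψ : ContDiff ℝ ∞ ψ) (i j : Fin n) (x : Coord n) :
    pderiv i (pderiv j ψ) x = pderiv j (pderiv i ψ) x := by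
  have hd : DifferentiableAt ℝ (fderiv ℝ ψ) x :=
    ((hψ.fderiv_right (m := ∞) (by norm_cast)).differentiable (by simp)) x
  have key : ∀ v w : Coord n, fderiv ℝ (fun z => fderiv ℝ ψ z w) x v
      = fderiv ℝ (fderiv ℝ ψ) x v w := by
    intro v w
    rw [fderiv_clm_apply hd (differentiableAt_const w)]
    simp
  have hs : IsSymmSndFDerivAt ℝ ψ x := hψ.contDiffAt.isSymmSndFDerivAt (by
    simp only [minSmoothness_of_isRCLikeNormedField]
    exact WithTop.coe_le_coe.2 (le_top : (2 : ℕ∞) ≤ ⊤))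
  change fderiv ℝ (fun z => fderiv ℝ ψ z _) x _ = fderiv ℝ (fun z => fderiv ℝ ψ z _) x _
  rw [key, key]
  exact hs _ _

/-- A weak gradient has weak curl zero. -/
theorem HasWeakGrad.hasWeakCurl (hdu : HasWeakGrad Ω u du) :
    HasWeakCurl Ω du (fun _ _ _ => 0) := by
  intro i j
  have h2 := fun i => (hdu i).locG
  refine ⟨locLp_curlField h2 i j, locLp_zero, fun ψ hψ => ?_⟩
  simp_rw [sum_curlField_mul _ i j _ fun k => pderiv k ψ _]
  have e1 := (hdu i).integral_eq _ (hψ.pderiv j)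
  have e2 := (hdu j).integral_eq _ (hψ.pderiv i)
  have i1 := integrable_weakDiv_integrand (hdu i).locV (h2 i) (hψ.pderiv j)
  have i2 := integrable_weakDiv_integrand (hdu j).locV (h2 j) (hψ.pderiv i)
  have e := congrArg₂ (· - ·) e1 e2
  simp only [sub_zero] at e
  rw [← integral_sub i1 i2] at e
  refine Eq.trans ?_ e
  congr 1; ext x
  rw [sum_singleField_mul i u x fun k => pderiv k (pderiv j ψ) x,
    sum_singleField_mul j u x fun k => pderiv k (pderiv i ψ) x, pderiv_comm hψ.1 i j]
  ring

/-- The gradient of a `C¹` function has weak curl zero. -/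
theorem hasWeakCurl_pderiv (hΩ : IsOpen Ω) (hu : ContDiffOn ℝ 1 u Ω) :
    HasWeakCurl Ω (fun i => pderiv i u) (fun _ _ _ => 0) :=
  (hasWeakGrad_of_contDiffOn hΩ hu).hasWeakCurl

theorem sum_pderiv_approx_singleField (T : Set (Coord n)) (k : ℕ) (i : Fin n)
    (u : Coord n → ℝ) (x : Coord n) :
    ∑ j, pderiv j (approx T k (singleField i u j)) x = pderiv i (approx T k u) x := by
  rw [Finset.sum_eq_single i]
  · rw [singleField_same]
  · intro j _ hj
    have : approx T k (singleField i u j) = fun _ => 0 := by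
      ext z
      have h0 : T.indicator (singleField i u j) = 0 := by
        ext t; simp [singleField_of_ne u hj]
      simp [approx, h0, moll_apply]
    rw [this]
    simp [pderiv]
  · simp

theorem HasWeakGrad.pderiv_approx (hdu : HasWeakGrad Ω u du) {S T : Set (Coord n)}
    (h : IsCollar S T Ω) {k : ℕ} {x : Coord n} (hx : Metric.closedBall x (bump n k).rOut ⊆ T)
    (i : Fin n) : pderiv i (approx T k u) x = approx T k (du i) x := by
  rw [← (hdu i).sum_pderiv_approx h hx, sum_pderiv_approx_singleField]

theorem IsCollar.approx_sub {S T : Set (Coord n)} (h : IsCollar S T Ω) (hu : LocLp Ω 1 u)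
    (hv : LocLp Ω 1 v) (k : ℕ) :
    approx T k (fun x => u x - v x) = fun x => approx T k u x - approx T k v x := by
  have hex : ∀ {f : Coord n → ℝ}, LocLp Ω 1 f → ∀ x,
      Integrable (fun t => mollKernel n k t * T.indicator f (x - t)) := fun hf x =>
    (hasCompactSupport_mollKernel k).convolutionExists_left (ContinuousLinearMap.lsmul ℝ ℝ)
      (contDiff_mollKernel k).continuous (h.locallyIntegrable_indicator hf) x
  ext x
  rw [approx, approx, approx, moll_apply, moll_apply, moll_apply, ← integral_sub (hex hu x)
    (hex hv x)]
  congr 1; ext t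
  by_cases ht : x - t ∈ T <;> simp [ht, mul_sub]

theorem HasWeakCurl.pderiv_approx {a : Fin n → Coord n → ℝ} {F : Fin n → Fin n → Coord n → ℝ}
    (ha : HasWeakCurl Ω a F) (ha1 : ∀ i, LocLp Ω 1 (a i)) {S T : Set (Coord n)}
    (h : IsCollar S T Ω) {k : ℕ} {x : Coord n} (hx : Metric.closedBall x (bump n k).rOut ⊆ T)
    (i j : Fin n) :
    pderiv j (approx T k (a i)) x - pderiv i (approx T k (a j)) x = approx T k (F i j) x := by
  rw [← (ha i j).sum_pderiv_approx h hx, ← sum_pderiv_approx_singleField T k j,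
    ← sum_pderiv_approx_singleField T k i, ← Finset.sum_sub_distrib]
  refine Finset.sum_congr rfl fun l _ => ?_
  have h1 := (ha1 i).singleField j l
  have h2 := (ha1 j).singleField i l
  have e : approx T k (curlField a i j l) = fun x =>
      approx T k (singleField j (a i) l) x - approx T k (singleField i (a j) l) x :=
    h.approx_sub h1 h2 k
  have hd := fun {f : Coord n → ℝ} (hf : LocLp Ω 1 f) =>
    (h.contDiff_approx hf k).differentiable (by simp) x
  rw [e, pderiv, pderiv, pderiv, fderiv_fun_sub (hd h1) (hd h2)]
  simp

/-- The product rule for a continuous function with weak gradient in `L^2_loc` and a vector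
field in `L^2_loc` with weak divergence: the function is mollified and the limit is taken. -/
theorem WeakDiv.mul_left {V : Fin n → Coord n → ℝ} {G : Coord n → ℝ} (hV : WeakDiv Ω V G)
    (hΩ : IsOpen Ω) (hu : ContinuousOn u Ω) (hdu : HasWeakGrad Ω u du)
    (hdu2 : ∀ i, LocLp Ω 2 (du i)) (hV2 : ∀ i, LocLp Ω 2 (V i)) :
    WeakDiv Ω (fun i x => u x * V i x) (fun x => u x * G x + ∑ i, du i x * V i x) := by
  have hprod : ∀ i, LocLp Ω 1 (fun x => du i x * V i x) := fun i => (hdu2 i).mul (hV2 i)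
  have hL1 := hu.locLp_one
  refine ⟨fun i => hu.locLp_top.mul (hV.locV i), (hu.locLp_top.mul hV.locG).add
    (LocLp.sum fun i _ => hprod i), fun ψ hψ => ?_⟩
  set S := tsupport ψ with hS
  have hSc : IsCompact S := hψ.2.1
  have hSm := hSc.measurableSet
  obtain ⟨T, hT⟩ := exists_isCollar hSc hΩ hψ.2.2
  set μ := (volume : Measure (Coord n)).restrict S
  set A : Coord n → ℝ := fun x => (∑ i, V i x * pderiv i ψ x) + G x * ψ x with hA
  have hA1 : Integrable A μ := (integrable_weakDiv_integrand hV.locV hV.locG hψ).integrableOn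
  have hz : ∀ x ∉ S, ψ x = 0 ∧ ∀ i, pderiv i ψ x = 0 := fun x hx =>
    ⟨image_eq_zero_of_notMem_tsupport hx, fun i => pderiv_eq_zero_of_notMem_tsupport i hx⟩
  have hψb : MemLp ψ ⊤ μ := (hψ.1.continuous.continuousOn (s := Ω)).locLp_top S hSc hψ.2.2
  have hVψ : ∀ i, MemLp (fun x => V i x * ψ x) 2 μ := fun i =>
    hψb.mul' ((hV2 i) S hSc hψ.2.2)
  have happ : ∀ {q : ℝ≥0∞} {f : Coord n → ℝ}, LocLp Ω 1 f → ∀ k, MemLp (approx T k f) q μ := by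
    intro q f hf k
    have := ((hT.contDiff_approx hf k).continuous.continuousOn (s := Ω)).locLp_top
    exact (this.mono_exponent le_top) S hSc hψ.2.2
  have hdu1 : ∀ i, LocLp Ω 1 (du i) := fun i => (hdu i).locG
  -- The weak divergence of `V` is tested against the mollification of `u` times `ψ`.
  have hk : ∀ᶠ k in atTop, (∫ x, A x * approx T k u x ∂μ)
      + ∑ i, ∫ x, (V i x * ψ x) * approx T k (du i) x ∂μ = 0 := by
    filter_upwards [hT.ball_subset] with k hk
    have hsm := hT.contDiff_approx hL1 k
    have e := hV.integral_eq _ (hψ.mul_left hsm)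
    rw [← integral_finsetSum _ fun i _ =>
        memLp_one_iff_integrable.1 ((happ (hdu1 i) k (q := 2)).mul' (hVψ i)),
      ← integral_add, ← e]
    · refine Eq.trans ?_ (setIntegral_eq_integral_of_forall_compl_eq_zero (s := S) ?_)
      · apply setIntegral_congr_fun hSm
        intro x hx
        have hp : ∀ i, pderiv i (fun z => approx T k u z * ψ z) x
            = approx T k u x * pderiv i ψ x + ψ x * approx T k (du i) x := by
          intro i
          rw [pderiv_mul (hsm.differentiable (by simp) x) (hψ.1.differentiable (by simp) x),
            hdu.pderiv_approx hT (hk x hx)]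
        simp only [hp, hA, mul_add, Finset.sum_add_distrib, add_mul, Finset.sum_mul]
        have s1 : ∀ i, V i x * (approx T k u x * pderiv i ψ x)
          = V i x * pderiv i ψ x * approx T k u x := fun i => by ring
        have s2 : ∀ i, V i x * (ψ x * approx T k (du i) x)
          = V i x * ψ x * approx T k (du i) x := fun i => by ring
        simp only [s1, s2]
        ring
      · intro x hx
        have hx' : x ∉ tsupport fun z => approx T k u z * ψ z := fun h =>
          hx (tsupport_mul_subset_right h)
        simp [pderiv_eq_zero_of_notMem_tsupport _ hx', (hz x hx).1]
    · exact memLp_one_iff_integrable.1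
        ((happ hL1 k (q := ⊤)).mul' (memLp_one_iff_integrable.2 hA1))
    · exact integrable_finsetSum _ fun i _ =>
        memLp_one_iff_integrable.1 ((happ (hdu1 i) k (q := 2)).mul' (hVψ i))
  have hlim : Tendsto (fun k => (∫ x, A x * approx T k u x ∂μ)
      + ∑ i, ∫ x, (V i x * ψ x) * approx T k (du i) x ∂μ) atTop
      (𝓝 ((∫ x, A x * u x ∂μ) + ∑ i, ∫ x, (V i x * ψ x) * du i x ∂μ)) := by
    have hA1' := memLp_one_iff_integrable.2 hA1
    refine Tendsto.add ?_ (tendsto_finsetSum _ fun i _ => ?_)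
    · refine tendsto_integral_mul (q₁ := 1) (q₂ := ⊤) (Eventually.of_forall fun k => hA1') hA1'
        (Eventually.of_forall fun k => happ hL1 k) (hu.locLp_top S hSc hψ.2.2) ?_
        (hT.tendsto_approx_top hSm hu)
      simp
    · refine tendsto_integral_mul (q₁ := 2) (q₂ := 2) (Eventually.of_forall fun k => hVψ i) (hVψ i)
        (Eventually.of_forall fun k => happ (hdu1 i) k) (hdu2 i S hSc hψ.2.2) ?_
        (hT.tendsto_approx hSm (by norm_num) (by simp) (hdu2 i))
      simp
  have hfin := tendsto_nhds_unique (hlim.congr' hk) tendsto_const_nhds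
  rw [← hfin, ← integral_finsetSum _ fun i _ =>
        memLp_one_iff_integrable.1 ((hdu2 i S hSc hψ.2.2).mul' (hVψ i)),
      ← integral_add, ← setIntegral_eq_integral_of_forall_compl_eq_zero (s := S)]
  · congr 1; ext x
    simp only [hA, add_mul, Finset.sum_mul]
    have s1 : ∀ i, V i x * pderiv i ψ x * u x = u x * V i x * pderiv i ψ x := fun i => by ring
    have s2 : ∀ i, V i x * ψ x * du i x = du i x * V i x * ψ x := fun i => by ring
    simp only [s1, s2]
    ring
  · intro x hx
    simp [(hz x hx).1, (hz x hx).2]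
  · exact memLp_one_iff_integrable.1
        ((hu.locLp_top S hSc hψ.2.2).mul' (memLp_one_iff_integrable.2 hA1))
  · exact integrable_finsetSum _ fun i _ =>
        memLp_one_iff_integrable.1 ((hdu2 i S hSc hψ.2.2).mul' (hVψ i))

theorem HasWeakGrad.mul (hΩ : IsOpen Ω) (hu : ContinuousOn u Ω) (hv : ContinuousOn v Ω)
    (hdu : HasWeakGrad Ω u du) (hdv : HasWeakGrad Ω v dv) (hdu2 : ∀ i, LocLp Ω 2 (du i)) :
    HasWeakGrad Ω (fun x => u x * v x) (fun i x => u x * dv i x + du i x * v x) := by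
  intro i
  refine ((hdv i).mul_left hΩ hu hdu hdu2 fun k =>
    (hv.locLp_top.mono_exponent le_top).singleField i k).congr (fun k => ?_) ?_
  · exact Eventually.of_forall fun x => by simp [singleField, mul_ite]
  · exact Eventually.of_forall fun x => by simp [singleField, mul_ite]

/-- The product rule for the curl: `d(u a) = u da + du ∧ a`. -/
theorem HasWeakCurl.mul_left {a : Fin n → Coord n → ℝ} {F : Fin n → Fin n → Coord n → ℝ}
    (ha : HasWeakCurl Ω a F) (hΩ : IsOpen Ω) (hu : ContinuousOn u Ω) (hdu : HasWeakGrad Ω u du)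
    (hdu2 : ∀ i, LocLp Ω 2 (du i)) (ha2 : ∀ i, LocLp Ω 2 (a i)) :
    HasWeakCurl Ω (fun i x => u x * a i x)
      (fun i j x => u x * F i j x + (du j x * a i x - du i x * a j x)) := by
  intro i j
  refine ((ha i j).mul_left hΩ hu hdu hdu2 (locLp_curlField ha2 i j)).congr (fun k => ?_) ?_
  · exact Eventually.of_forall fun x => by simp [curlField, singleField, mul_sub, mul_ite]
  · refine Eventually.of_forall fun x => ?_
    have := sum_curlField_mul a i j x fun k => du k x
    simp only [mul_comm (curlField a i j _ x)] at this
    simp only [this]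
    ring

theorem WeakDiv.ae_unique {V : Fin n → Coord n → ℝ} {G H : Coord n → ℝ} (hΩ : IsOpen Ω)
    (h : WeakDiv Ω V G) (h' : WeakDiv Ω V H) : ∀ᵐ x ∂volume.restrict Ω, G x = H x := by
  have hd := h.sub h'
  have hloc : LocallyIntegrableOn (fun x => G x - H x) Ω volume :=
    (locallyIntegrableOn_iff hΩ.isLocallyClosed).2 fun K hK hKc =>
      memLp_one_iff_integrable.1 (hd.locG K hKc hK)
  have := hΩ.ae_eq_zero_of_integral_contDiff_smul_eq_zero hloc fun g hg hgc hgΩ => by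
    have := hd.integral_eq g ⟨hg, hgc, hgΩ⟩
    simpa [mul_comm] using this
  rw [ae_restrict_iff' hΩ.measurableSet]
  filter_upwards [this] with x hx hxΩ
  exact sub_eq_zero.1 (hx hxΩ)

end

/-! ### Continuous functions with square-integrable weak gradient -/

section

variable {Ω : Set (Coord n)} {u v : Coord n → ℝ} {du : Fin n → Coord n → ℝ}

theorem pderiv_inv {f : Coord n → ℝ} {x : Coord n} (hf : DifferentiableAt ℝ f x) (h0 : f x ≠ 0)
    (i : Fin n) : pderiv i (fun z => (f z)⁻¹) x = -(((f x)⁻¹) ^ 2) * pderiv i f x := by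
  have := (hasDerivAt_inv h0).comp_hasFDerivAt x hf.hasFDerivAt
  rw [pderiv, HasFDerivAt.fderiv (f := fun z => (f z)⁻¹) this]
  simp [pderiv]

/-- The chain rule for the reciprocal of a continuous function without zeros: the function is
mollified, which on a given compact set also keeps it away from zero. -/
theorem HasWeakGrad.inv (hΩ : IsOpen Ω) (hu : ContinuousOn u Ω) (h0 : ∀ x ∈ Ω, u x ≠ 0)
    (hdu : HasWeakGrad Ω u du) :
    HasWeakGrad Ω (fun x => (u x)⁻¹) (fun i x => -((u x)⁻¹ ^ 2) * du i x) := by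
  intro i
  have hr : ContinuousOn (fun x => (u x)⁻¹) Ω := hu.inv₀ h0
  have hr2 : ContinuousOn (fun x => -((u x)⁻¹ ^ 2)) Ω := (hr.pow 2).neg
  have hdi : LocLp Ω 1 (du i) := (hdu i).locG
  have hu1 := hu.locLp_one
  refine ⟨fun k => hr.locLp_one.singleField i k, hr2.locLp_top.mul hdi, fun ψ hψ => ?_⟩
  simp_rw [sum_singleField_mul i _ _ fun k => pderiv k ψ _]
  set S := tsupport ψ
  have hSc : IsCompact S := hψ.2.1
  have hSm := hSc.measurableSet
  obtain ⟨T, hT⟩ := exists_isCollar hSc hΩ hψ.2.2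
  set μ := (volume : Measure (Coord n)).restrict S
  obtain ⟨C₀, hC₀⟩ := hSc.exists_bound_of_continuousOn (hr.mono hψ.2.2)
  set C := max C₀ 1
  have hC1 : 1 ≤ C := le_max_right _ _
  have hC : ∀ x ∈ S, |(u x)⁻¹| ≤ C := fun x hx => (hC₀ x hx).trans (le_max_left _ _)
  obtain ⟨M, hM⟩ := hψ.1.continuous.bounded_above_of_compact_support hψ.2.1
  have hM0 : 0 ≤ M := (norm_nonneg _).trans (hM 0)
  set d : ℕ → Coord n → ℝ := fun k => approx T k u
  have hdsm : ∀ k, ContDiff ℝ ∞ (d k) := fun k => hT.contDiff_approx hu1 k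
  -- On `S` the approximations `d k` are eventually bounded below by `1 / (2 * C)`.
  have hlow : ∀ᶠ k in atTop, ∀ x ∈ S, d k x ≠ 0 ∧ |(d k x)⁻¹| ≤ 2 * C := by
    filter_upwards [hT.eventually_abs_approx_sub_le hu (ε := 1 / (2 * C)) (by positivity)]
      with k hk x hx
    have hux : 1 / C ≤ |u x| := by
      have := hC x hx
      rw [abs_inv] at this
      rw [one_div]
      exact inv_le_of_inv_le₀ (abs_pos.2 (h0 x (hψ.2.2 hx))) this
    have h3 : |u x| ≤ |d k x| + |d k x - u x| := by
      have := abs_sub_abs_le_abs_sub (u x) (d k x)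
      rw [abs_sub_comm] at this
      linarith
    have h4 : 1 / (2 * C) ≤ |d k x| := by
      have h5 := hk x hx
      have h6 : 1 / C = 1 / (2 * C) + 1 / (2 * C) := by field_simp; norm_num
      change |d k x - u x| ≤ _ at h5
      linarith
    have hpos : 0 < 1 / (2 * C) := by positivity
    refine ⟨abs_pos.1 (hpos.trans_le h4), ?_⟩
    rw [abs_inv]
    exact inv_le_of_inv_le₀ (by positivity) (by rwa [← one_div])
  have hinv : ∀ ε > 0, ∀ᶠ k in atTop, ∀ x ∈ S, |(d k x)⁻¹ - (u x)⁻¹| ≤ ε := by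
    intro ε hε
    filter_upwards [hlow, hT.eventually_abs_approx_sub_le hu (ε := ε / (2 * C * C))
      (by positivity)] with k hk hk2 x hx
    have hux := h0 x (hψ.2.2 hx)
    have e : (d k x)⁻¹ - (u x)⁻¹ = -((d k x)⁻¹ * (u x)⁻¹ * (d k x - u x)) := by
      have := (hk x hx).1
      field_simp
      ring
    rw [e, abs_neg, abs_mul, abs_mul]
    calc _ ≤ (2 * C) * C * (ε / (2 * C * C)) := by
          gcongr
          · exact (hk x hx).2
          · exact hC x hx
          · exact hk2 x hx
      _ = ε := by field_simp
  have hinv2 : ∀ ε > 0, ∀ᶠ k in atTop, ∀ x ∈ S,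
      |-((d k x)⁻¹ ^ 2) * ψ x - -((u x)⁻¹ ^ 2) * ψ x| ≤ ε := by
    intro ε hε
    filter_upwards [hlow, hinv (ε / (3 * C * (M + 1))) (by positivity)] with k hk hk2 x hx
    have e : -((d k x)⁻¹ ^ 2) * ψ x - -((u x)⁻¹ ^ 2) * ψ x
        = -(((d k x)⁻¹ - (u x)⁻¹) * ((d k x)⁻¹ + (u x)⁻¹) * ψ x) := by ring
    rw [e, abs_neg, abs_mul, abs_mul]
    calc _ ≤ (ε / (3 * C * (M + 1))) * (2 * C + C) * (M + 1) := by
          gcongr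
          · exact hk2 x hx
          · exact (abs_add_le _ _).trans (add_le_add (hk x hx).2 (hC x hx))
          · exact (hM x).trans (by linarith)
      _ = ε := by field_simp; ring
  have hcont : ∀ᶠ k in atTop, ContinuousOn (fun x => (d k x)⁻¹) S := by
    filter_upwards [hlow] with k hk
    exact (hdsm k).continuous.continuousOn.inv₀ fun x hx => (hk x hx).1
  have hψc : ContinuousOn ψ S := hψ.1.continuous.continuousOn
  have hψi : MemLp (pderiv i ψ) 1 μ :=
    ((hψ.pderiv i).1.continuous.continuousOn (s := S)).locLp_one S hSc le_rfl
  have hk : ∀ᶠ k in atTop, (∫ x, (d k x)⁻¹ * pderiv i ψ x ∂μ)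
      + ∫ x, (-((d k x)⁻¹ ^ 2) * ψ x) * approx T k (du i) x ∂μ = 0 := by
    filter_upwards [hT.ball_subset, hlow, hcont] with k hk hkl hkc
    -- The classical gradient of `1 / d k` is used on the open set where `d k` does not vanish.
    have hop : IsOpen {x | d k x ≠ 0} := isOpen_ne_fun (hdsm k).continuous continuous_const
    have hC1 : ContDiffOn ℝ 1 (fun x => (d k x)⁻¹) {x | d k x ≠ 0} :=
      ((hdsm k).of_le (by norm_cast)).contDiffOn.inv fun x hx => hx
    have e := (hasWeakGrad_of_contDiffOn hop hC1 i).integral_eq ψ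
      ⟨hψ.1, hψ.2.1, fun x hx => (hkl x hx).1⟩
    simp_rw [sum_singleField_mul i _ _ fun k => pderiv k ψ _] at e
    rw [← integral_add, ← e]
    · refine Eq.trans ?_ (setIntegral_eq_integral_of_forall_compl_eq_zero (s := S) ?_)
      · apply setIntegral_congr_fun hSm
        intro x hx
        simp only
        rw [pderiv_inv ((hdsm k).differentiable (by simp) x) (hkl x hx).1,
          hdu.pderiv_approx hT (hk x hx)]
        ring
      · intro x hx
        simp [image_eq_zero_of_notMem_tsupport hx, pderiv_eq_zero_of_notMem_tsupport i hx]
    · exact memLp_one_iff_integrable.1 (hψi.mul' (hkc.locLp_top S hSc le_rfl))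
    · refine memLp_one_iff_integrable.1 (MemLp.mul' (p := ⊤) (q := 1) ?_ ?_)
      · exact ((hT.contDiff_approx hdi k).continuous.continuousOn (s := S)).locLp_one S hSc le_rfl
      · exact ((hkc.pow 2).neg.mul hψc).locLp_top S hSc le_rfl
  have hlim : Tendsto (fun k => (∫ x, (d k x)⁻¹ * pderiv i ψ x ∂μ)
      + ∫ x, (-((d k x)⁻¹ ^ 2) * ψ x) * approx T k (du i) x ∂μ) atTop
      (𝓝 ((∫ x, (u x)⁻¹ * pderiv i ψ x ∂μ) + ∫ x, (-((u x)⁻¹ ^ 2) * ψ x) * du i x ∂μ)) := by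
    refine Tendsto.add ?_ ?_
    · refine tendsto_integral_mul (q₁ := ⊤) (q₂ := 1) ?_ (hr.locLp_top S hSc hψ.2.2)
        (Eventually.of_forall fun _ => hψi) hψi (tendsto_eLpNorm_top_of_bound hSm hinv) (by simp)
      filter_upwards [hcont] with k hk using hk.locLp_top S hSc le_rfl
    · refine tendsto_integral_mul (q₁ := ⊤) (q₂ := 1) ?_ ?_ (Eventually.of_forall fun k => ?_)
        (hdi S hSc hψ.2.2) (tendsto_eLpNorm_top_of_bound hSm hinv2)
        (hT.tendsto_approx hSm le_rfl (by simp) hdi)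
      · filter_upwards [hcont] with k hk
        exact ((hk.pow 2).neg.mul hψc).locLp_top S hSc le_rfl
      · exact ((hr2.mono hψ.2.2).mul hψc).locLp_top S hSc le_rfl
      · exact ((hT.contDiff_approx hdi k).continuous.continuousOn (s := S)).locLp_one S hSc le_rfl
  have hfin := tendsto_nhds_unique (hlim.congr' hk) tendsto_const_nhds
  rw [← hfin, ← integral_add, ← setIntegral_eq_integral_of_forall_compl_eq_zero (s := S)]
  · congr 1; ext x
    ring
  · intro x hx
    simp [image_eq_zero_of_notMem_tsupport hx, pderiv_eq_zero_of_notMem_tsupport i hx]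
  · exact memLp_one_iff_integrable.1 (hψi.mul' (hr.locLp_top S hSc hψ.2.2))
  · exact memLp_one_iff_integrable.1 ((hdi S hSc hψ.2.2).mul'
      (((hr2.mono hψ.2.2).mul hψc).locLp_top S hSc le_rfl))

/-- `u` is continuous on `Ω` and has a weak gradient in `L^2_loc(Ω)`. -/
def IsSobolev (Ω : Set (Coord n)) (u : Coord n → ℝ) : Prop :=
  ContinuousOn u Ω ∧ ∃ du, HasWeakGrad Ω u du ∧ ∀ i, LocLp Ω 2 (du i)

theorem HasWeakGrad.add {dv : Fin n → Coord n → ℝ} (hdu : HasWeakGrad Ω u du)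
    (hdv : HasWeakGrad Ω v dv) :
    HasWeakGrad Ω (fun x => u x + v x) (fun i x => du i x + dv i x) := by
  intro i
  refine ((hdu i).add (hdv i)).congr (fun k => Eventually.of_forall fun x => ?_)
    (Eventually.of_forall fun x => rfl)
  by_cases h : k = i <;> simp [singleField, h]

theorem hasWeakGrad_const (hΩ : IsOpen Ω) (c : ℝ) :
    HasWeakGrad Ω (fun _ => c) (fun _ _ => 0) := by
  have := hasWeakGrad_of_contDiffOn hΩ (u := fun _ => c) contDiffOn_const
  have e : ∀ i, pderiv i (fun _ : Coord n => c) = fun _ => 0 := fun i => by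
    ext x; simp [pderiv]
  simpa only [e] using this

theorem HasWeakGrad.sum {ι : Type*} (hΩ : IsOpen Ω) (s : Finset ι) {u : ι → Coord n → ℝ}
    {du : ι → Fin n → Coord n → ℝ} (h : ∀ a, HasWeakGrad Ω (u a) (du a)) :
    HasWeakGrad Ω (fun x => ∑ a ∈ s, u a x) (fun i x => ∑ a ∈ s, du a i x) := by
  classical
  induction s using Finset.induction_on with
  | empty => simpa using hasWeakGrad_const hΩ 0
  | insert a s ha ih => simpa only [Finset.sum_insert ha] using (h a).add ih

theorem isSobolev_const (hΩ : IsOpen Ω) (c : ℝ) : IsSobolev Ω fun _ => c :=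
  ⟨continuousOn_const, _, hasWeakGrad_const hΩ c, fun _ => locLp_zero⟩

theorem IsSobolev.add (hu : IsSobolev Ω u) (hv : IsSobolev Ω v) :
    IsSobolev Ω fun x => u x + v x := by
  obtain ⟨cu, du, hdu, hu2⟩ := hu
  obtain ⟨cv, dv, hdv, hv2⟩ := hv
  exact ⟨cu.add cv, _, hdu.add hdv, fun i => (hu2 i).add (hv2 i)⟩

theorem IsSobolev.mul (hΩ : IsOpen Ω) (hu : IsSobolev Ω u) (hv : IsSobolev Ω v) :
    IsSobolev Ω fun x => u x * v x := by
  obtain ⟨cu, du, hdu, hu2⟩ := hu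
  obtain ⟨cv, dv, hdv, hv2⟩ := hv
  exact ⟨cu.mul cv, _, hdu.mul hΩ cu cv hdv hu2,
    fun i => (cu.locLp_top.mul (hv2 i)).add ((hu2 i).mul cv.locLp_top)⟩

theorem IsSobolev.inv (hΩ : IsOpen Ω) (hu : IsSobolev Ω u) (h0 : ∀ x ∈ Ω, u x ≠ 0) :
    IsSobolev Ω fun x => (u x)⁻¹ := by
  obtain ⟨cu, du, hdu, hu2⟩ := hu
  exact ⟨cu.inv₀ h0, _, hdu.inv hΩ cu h0,
    fun i => (((cu.inv₀ h0).pow 2).neg.locLp_top).mul (hu2 i)⟩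

theorem IsSobolev.sum {ι : Type*} (hΩ : IsOpen Ω) (s : Finset ι) {u : ι → Coord n → ℝ}
    (h : ∀ a, IsSobolev Ω (u a)) : IsSobolev Ω fun x => ∑ a ∈ s, u a x := by
  classical
  induction s using Finset.induction_on with
  | empty => simpa using isSobolev_const hΩ 0
  | insert a s ha ih => simpa only [Finset.sum_insert ha] using (h a).add ih

theorem IsSobolev.prod {ι : Type*} (hΩ : IsOpen Ω) (s : Finset ι) {u : ι → Coord n → ℝ}
    (h : ∀ a, IsSobolev Ω (u a)) : IsSobolev Ω fun x => ∏ a ∈ s, u a x := by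
  classical
  induction s using Finset.induction_on with
  | empty => simpa using isSobolev_const hΩ 1
  | insert a s ha ih => simpa only [Finset.prod_insert ha] using (h a).mul hΩ ih

section Matrix

variable {ι : Type*} [Fintype ι] [DecidableEq ι] {A B : Coord n → Matrix ι ι ℝ}

theorem IsSobolev.det (hΩ : IsOpen Ω) (hA : ∀ i j, IsSobolev Ω fun x => A x i j) :
    IsSobolev Ω fun x => (A x).det := by
  simp only [Matrix.det_apply']
  exact IsSobolev.sum hΩ _ fun σ =>
    (isSobolev_const hΩ _).mul hΩ (IsSobolev.prod hΩ _ fun i => hA (σ i) i)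

theorem IsSobolev.adjugate (hΩ : IsOpen Ω) (hA : ∀ i j, IsSobolev Ω fun x => A x i j) (i j : ι) :
    IsSobolev Ω fun x => (A x).adjugate i j := by
  simp only [Matrix.adjugate_apply]
  refine IsSobolev.det hΩ fun a b => ?_
  by_cases h : a = j
  · subst h
    simpa using isSobolev_const hΩ _
  · simpa [Matrix.updateRow_ne h] using hA a b

theorem IsSobolev.congr (hu : IsSobolev Ω u) (h : ∀ x ∈ Ω, u x = v x) (hΩ : IsOpen Ω) :
    IsSobolev Ω v := by
  obtain ⟨cu, du, hdu, hu2⟩ := hu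
  refine ⟨cu.congr fun x hx => (h x hx).symm, du, fun i => (hdu i).congr (fun k => ?_)
    (Eventually.of_forall fun _ => rfl), hu2⟩
  filter_upwards [ae_restrict_mem hΩ.measurableSet] with x hx
  simp [singleField, h x hx]

/-- The entries of the inverse of a matrix of continuous functions with weak gradients in
`L^2_loc` are of the same kind, by Cramer's rule. -/
theorem IsSobolev.of_mul_eq_one (hΩ : IsOpen Ω) (hA : ∀ i j, IsSobolev Ω fun x => A x i j)
    (hAB : ∀ x ∈ Ω, A x * B x = 1) (i j : ι) : IsSobolev Ω fun x => B x i j := by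
  have hdet : ∀ x ∈ Ω, (A x).det ≠ 0 := fun x hx h => by
    have := congrArg Matrix.det (hAB x hx)
    simp [h] at this
  refine ((((IsSobolev.det hΩ hA).inv hΩ hdet)).mul hΩ
    (IsSobolev.adjugate hΩ hA i j)).congr (fun x hx => ?_) hΩ
  rw [← Matrix.inv_eq_right_inv (hAB x hx), Matrix.inv_def, Ring.inverse_eq_inv']
  simp

/-- The derivative of the inverse matrix, `dB = -B dA B`, with its weak meaning. -/
theorem hasWeakGrad_of_mul_eq_one (hΩ : IsOpen Ω) (hc : ∀ i j, ContinuousOn (fun x => A x i j) Ω)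
    {dA : ι → ι → Fin n → Coord n → ℝ} (hdA : ∀ i j, HasWeakGrad Ω (fun x => A x i j) (dA i j))
    (hdA2 : ∀ i j k, LocLp Ω 2 (dA i j k)) (hAB : ∀ x ∈ Ω, A x * B x = 1) :
    (∀ i j, ContinuousOn (fun x => B x i j) Ω) ∧
    (∀ i j, HasWeakGrad Ω (fun x => B x i j)
      fun k x => -∑ a, ∑ b, B x i a * dA a b k x * B x b j) ∧
    ∀ i j k, LocLp Ω 2 (fun x => -∑ a, ∑ b, B x i a * dA a b k x * B x b j) := by
  have hB := fun i j => IsSobolev.of_mul_eq_one hΩ (fun i j => ⟨hc i j, _, hdA i j, hdA2 i j⟩)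
    hAB i j
  have hBc := fun i j => (hB i j).1
  choose dB hdB hdB2 using fun i j => (hB i j).2
  -- Differentiating the entry `(a, j)` of `A * B = 1`.
  have key : ∀ a j k, ∀ᵐ x ∂volume.restrict Ω,
      ∑ b, (A x a b * dB b j k x + dA a b k x * B x b j) = 0 := by
    intro a j k
    have h1 := HasWeakGrad.sum hΩ Finset.univ fun b =>
      HasWeakGrad.mul hΩ (hc a b) (hBc b j) (hdA a b) (hdB b j) (hdA2 a b)
    have h2 := hasWeakGrad_const hΩ ((1 : Matrix ι ι ℝ) a j)
    refine (h1 k).ae_unique hΩ ((h2 k).congr (fun l => ?_) (Eventually.of_forall fun _ => rfl))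
    filter_upwards [ae_restrict_mem hΩ.measurableSet] with x hx
    simp [singleField, ← hAB x hx, Matrix.mul_apply]
  have hae : ∀ i j k, ∀ᵐ x ∂volume.restrict Ω,
      dB i j k x = -∑ a, ∑ b, B x i a * dA a b k x * B x b j := by
    intro i j k
    filter_upwards [ae_all_iff.2 fun a => key a j k, ae_restrict_mem hΩ.measurableSet]
      with x hx hxΩ
    have hBA : B x * A x = 1 := mul_eq_one_comm.1 (hAB x hxΩ)
    have e1 : ∑ a, B x i a * ∑ b, (A x a b * dB b j k x + dA a b k x * B x b j) = 0 := by
      simp [hx]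
    have e2 : ∑ a, ∑ b, B x i a * (A x a b * dB b j k x) = dB i j k x := by
      rw [Finset.sum_comm]
      have : ∀ b, ∑ a, B x i a * (A x a b * dB b j k x) = (B x * A x) i b * dB b j k x := by
        intro b
        rw [Matrix.mul_apply, Finset.sum_mul]
        exact Finset.sum_congr rfl fun a _ => by ring
      simp only [this, hBA, Matrix.one_apply, ite_mul, one_mul, zero_mul, Finset.sum_ite_eq,
        Finset.mem_univ, if_true]
    simp only [Finset.mul_sum, mul_add, Finset.sum_add_distrib] at e1
    simp only [mul_assoc] at e1 e2 ⊢
    rw [e2] at e1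
    linarith
  refine ⟨hBc, fun i j k => (hdB i j k).congr (fun _ => Eventually.of_forall fun _ => rfl)
    (hae i j k), fun i j k => (hdB2 i j k).congr (hae i j k)⟩

end Matrix

end

/-! ### Coordinate transformations -/

theorem clm_apply_eq_sum (L : Coord n →L[ℝ] ℝ) (v : Coord n) :
    L v = ∑ j, L (EuclideanSpace.single j 1) * v j := by
  conv_lhs => rw [← (EuclideanSpace.basisFun (Fin n) ℝ).sum_repr v]
  simp [mul_comm]

section

variable {y : OpenPartialHomeomorph (Coord n) (Coord n)}

theorem IsCoordTransformation.symm (hy : IsCoordTransformation y) :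
    IsCoordTransformation y.symm :=
  ⟨hy.2, by simpa using hy.1⟩

theorem IsCoordTransformation.differentiableAt (hy : IsCoordTransformation y) {x : Coord n}
    (hx : x ∈ y.source) : DifferentiableAt ℝ y x :=
  (hy.1.differentiableOn one_ne_zero).differentiableAt (y.open_source.mem_nhds hx)

theorem IsCoordTransformation.contDiffOn_coord (hy : IsCoordTransformation y) (α : Fin n) :
    ContDiffOn ℝ 1 (fun x => y x α) y.source :=
  (contDiffOn_euclidean.1 hy.1) α

theorem IsCoordTransformation.jac_eq (hy : IsCoordTransformation y) {x : Coord n}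
    (hx : x ∈ y.source) (α μ : Fin n) :
    jac y α μ x = fderiv ℝ y x (EuclideanSpace.single μ 1) α := by
  have h : HasFDerivAt (fun z => y z α) ((EuclideanSpace.proj (𝕜 := ℝ) α).comp (fderiv ℝ y x)) x :=
    (EuclideanSpace.proj (𝕜 := ℝ) α).hasFDerivAt.comp x (hy.differentiableAt hx).hasFDerivAt
  rw [jac, pderiv, h.fderiv]
  rfl

theorem IsCoordTransformation.continuousOn_jac (hy : IsCoordTransformation y) (α μ : Fin n) :
    ContinuousOn (jac y α μ) y.source :=
  continuousOn_pderiv y.open_source (hy.contDiffOn_coord α) μ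

theorem IsCoordTransformation.continuousOn_invJac (hy : IsCoordTransformation y) (μ α : Fin n) :
    ContinuousOn (invJac y μ α) y.source :=
  (hy.symm.continuousOn_jac μ α).comp y.continuousOn y.mapsTo

/-- The chain rule in coordinates. -/
theorem IsCoordTransformation.pderiv_comp (hy : IsCoordTransformation y) {f : Coord n → ℝ}
    {x : Coord n} (hx : x ∈ y.source) (hf : DifferentiableAt ℝ f (y x)) (i : Fin n) :
    pderiv i (fun z => f (y z)) x = ∑ j, pderiv j f (y x) * jac y j i x := by
  have h : HasFDerivAt (fun z => f (y z)) _ x :=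
    hf.hasFDerivAt.comp x (hy.differentiableAt hx).hasFDerivAt
  rw [pderiv, h.fderiv, ContinuousLinearMap.comp_apply, clm_apply_eq_sum]
  exact Finset.sum_congr rfl fun j _ => by rw [hy.jac_eq hx]; rfl

theorem IsCoordTransformation.sum_jac_mul_invJac (hy : IsCoordTransformation y) {x : Coord n}
    (hx : x ∈ y.source) (α β : Fin n) :
    ∑ μ, jac y α μ x * invJac y μ β x = if α = β then 1 else 0 := by
  have hyx : y x ∈ y.symm.source := y.map_source hx
  have hx' : y.symm (y x) = x := y.left_inv hx
  have hd : DifferentiableAt ℝ (fun z => y z α) (y.symm (y x)) := by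
    rw [hx']
    exact ((hy.contDiffOn_coord α).differentiableOn one_ne_zero).differentiableAt
      (y.open_source.mem_nhds hx)
  have h := hy.symm.pderiv_comp hyx hd β
  rw [hx'] at h
  have e : (fun z => y (y.symm z) α) =ᶠ[𝓝 (y x)] fun z => z α := by
    filter_upwards [y.open_target.mem_nhds hyx] with z hz
    rw [y.right_inv hz]
  have e2 : pderiv β (fun z => y (y.symm z) α) (y x) = if α = β then 1 else 0 := by
    rw [pderiv, e.fderiv_eq]
    have : HasFDerivAt (fun z : Coord n => z α) (EuclideanSpace.proj (𝕜 := ℝ) α) (y x) :=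
      (EuclideanSpace.proj (𝕜 := ℝ) α).hasFDerivAt
    rw [this.fderiv]
    simp
  rw [← e2, h]
  rfl

theorem invJac_symm_apply {z : Coord n} (hz : z ∈ y.target) (μ α : Fin n) :
    invJac y μ α (y.symm z) = jac y.symm μ α z := by
  rw [invJac, y.right_inv hz]

/-! ### Change of variables in Lebesgue spaces -/

theorem measurableSet_image_of_subset_source {E : Set (Coord n)} (hE : MeasurableSet E)
    (hEs : E ⊆ y.source) : MeasurableSet (y '' E) :=
  hE.image_of_continuousOn_injOn (y.continuousOn.mono hEs) (y.injOn.mono hEs)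

/-- A coordinate transformation with Jacobian determinant at most `C` on `E` increases volumes
of subsets of `E` at most by the factor `C`. -/
theorem IsCoordTransformation.map_symm_restrict_le (hy : IsCoordTransformation y)
    {E : Set (Coord n)} (hE : MeasurableSet E) (hEs : E ⊆ y.source) {C : ℝ}
    (hC : ∀ x ∈ E, |(fderiv ℝ y x).det| ≤ C) :
    AEMeasurable y.symm (volume.restrict (y '' E)) ∧
    Measure.map y.symm (volume.restrict (y '' E)) ≤ ENNReal.ofReal C • volume.restrict E := by
  have hm := measurableSet_image_of_subset_source hE hEs
  have hae : AEMeasurable y.symm (volume.restrict (y '' E)) :=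
    (y.symm.continuousOn.mono (by
      rintro _ ⟨x, hx, rfl⟩; exact y.map_source (hEs hx))).aemeasurable hm
  refine ⟨hae, Measure.le_iff.2 fun A hA => ?_⟩
  rw [Measure.map_apply_of_aemeasurable hae hA, Measure.restrict_apply' hm, Measure.smul_apply,
    Measure.restrict_apply hA, smul_eq_mul]
  have hsub : y.symm ⁻¹' A ∩ y '' E ⊆ y '' (A ∩ E) := by
    rintro _ ⟨hz, x, hx, rfl⟩
    exact ⟨x, ⟨by simpa [y.left_inv (hEs hx)] using hz, hx⟩, rfl⟩
  have hAE := hA.inter hE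
  have hAEs : A ∩ E ⊆ y.source := inter_subset_right.trans hEs
  calc volume (y.symm ⁻¹' A ∩ y '' E) ≤ volume (y '' (A ∩ E)) := measure_mono hsub
    _ = ∫⁻ x in A ∩ E, ENNReal.ofReal |(fderiv ℝ y x).det| :=
        (lintegral_abs_det_fderiv_eq_addHaar_image volume hAE
          (fun x hx => (hy.differentiableAt (hAEs hx)).hasFDerivAt.hasFDerivWithinAt)
          (y.injOn.mono hAEs)).symm
    _ ≤ ∫⁻ _ in A ∩ E, ENNReal.ofReal C :=
        setLIntegral_mono' hAE fun x hx => ENNReal.ofReal_le_ofReal (hC x hx.2)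
    _ = _ := by simp

theorem IsCoordTransformation.memLp_comp_symm (hy : IsCoordTransformation y)
    {E : Set (Coord n)} (hE : MeasurableSet E) (hEs : E ⊆ y.source) {C : ℝ}
    (hC : ∀ x ∈ E, |(fderiv ℝ y x).det| ≤ C) {q : ℝ≥0∞} {f : Coord n → ℝ}
    (hf : MemLp f q (volume.restrict E)) :
    MemLp (fun z => f (y.symm z)) q (volume.restrict (y '' E)) := by
  obtain ⟨hae, hle⟩ := hy.map_symm_restrict_le hE hEs hC
  exact ((hf.smul_measure ENNReal.ofReal_ne_top).mono_measure hle).comp_of_map hae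

theorem IsCoordTransformation.eLpNorm_comp_symm_le (hy : IsCoordTransformation y)
    {E : Set (Coord n)} (hE : MeasurableSet E) (hEs : E ⊆ y.source) {C : ℝ}
    (hC : ∀ x ∈ E, |(fderiv ℝ y x).det| ≤ C) {f : Coord n → ℝ}
    (hf : AEStronglyMeasurable f (volume.restrict E)) :
    eLpNorm (fun z => f (y.symm z)) 1 (volume.restrict (y '' E))
      ≤ ENNReal.ofReal C * eLpNorm f 1 (volume.restrict E) := by
  obtain ⟨hae, hle⟩ := hy.map_symm_restrict_le hE hEs hC
  have hfm : AEStronglyMeasurable f (Measure.map y.symm (volume.restrict (y '' E))) :=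
    (hf.smul_measure _).mono_measure hle
  have := eLpNorm_map_measure (p := 1) hfm hae
  calc _ = eLpNorm f 1 (Measure.map y.symm (volume.restrict (y '' E))) := this.symm
    _ ≤ eLpNorm f 1 (ENNReal.ofReal C • volume.restrict E) := eLpNorm_mono_measure _ hle
    _ = _ := by rw [eLpNorm_one_smul_measure]

theorem IsCoordTransformation.exists_det_le (hy : IsCoordTransformation y) {K : Set (Coord n)}
    (hK : IsCompact K) (hKs : K ⊆ y.source) : ∃ C, ∀ x ∈ K, |(fderiv ℝ y x).det| ≤ C := by
  have hc : ContinuousOn (fun x => (fderiv ℝ y x).det) y.source :=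
    ContinuousLinearMap.continuous_det.comp_continuousOn
      (hy.1.continuousOn_fderiv_of_isOpen y.open_source le_rfl)
  exact hK.exists_bound_of_continuousOn (hc.mono hKs)

theorem image_symm_image {K : Set (Coord n)} (hK : K ⊆ y.target) : y '' (y.symm '' K) = K := by
  rw [image_image]
  exact (image_congr fun z hz => y.right_inv (hK hz)).trans (image_id' K)

theorem isCompact_symm_image {K : Set (Coord n)} (hK : IsCompact K) (hKt : K ⊆ y.target) :
    IsCompact (y.symm '' K) ∧ y.symm '' K ⊆ y.source :=
  ⟨hK.image_of_continuousOn (y.symm.continuousOn.mono hKt), by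
    rintro _ ⟨z, hz, rfl⟩; exact y.map_target (hKt hz)⟩

theorem IsCoordTransformation.locLp_comp_symm (hy : IsCoordTransformation y) {q : ℝ≥0∞}
    {f : Coord n → ℝ} (hf : LocLp y.source q f) :
    LocLp y.target q fun z => f (y.symm z) := by
  intro K hK hKt
  obtain ⟨h1, h2⟩ := isCompact_symm_image hK hKt
  obtain ⟨C, hC⟩ := hy.exists_det_le h1 h2
  have := hy.memLp_comp_symm h1.measurableSet h2 hC (hf _ h1 h2)
  rwa [image_symm_image hKt] at this

theorem IsCoordTransformation.ae_comp_symm (hy : IsCoordTransformation y) {P : Coord n → Prop}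
    (h : ∀ᵐ x ∂volume.restrict y.source, P x) :
    ∀ᵐ z ∂volume.restrict y.target, P (y.symm z) := by
  rw [ae_restrict_iff' y.open_source.measurableSet] at h
  rw [ae_restrict_iff' y.open_target.measurableSet]
  have h0 : volume (y '' {x | ¬(x ∈ y.source → P x)}) = 0 := by
    refine addHaar_image_eq_zero_of_differentiableOn_of_addHaar_eq_zero volume
      (fun x hx => ?_) h
    have hx' : x ∈ y.source := by
      by_contra h'
      exact hx fun h'' => absurd h'' h'
    exact (hy.differentiableAt hx').differentiableWithinAt
  refine measure_mono_null (fun z hz => ?_) h0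
  simp only [mem_compl_iff, mem_ofPred_eq, Classical.not_imp] at hz ⊢
  exact ⟨y.symm z, by simpa using ⟨y.map_target hz.1, hz.2⟩, y.right_inv hz.1⟩

end

/-! ### The weak curl under coordinate transformations -/

section

variable {φ : OpenPartialHomeomorph (Coord n) (Coord n)}

theorem HasWeakCurl.sum {Ω : Set (Coord n)} {ι : Type*} (s : Finset ι)
    {a : ι → Fin n → Coord n → ℝ} {F : ι → Fin n → Fin n → Coord n → ℝ}
    (h : ∀ m, HasWeakCurl Ω (a m) (F m)) :
    HasWeakCurl Ω (fun i x => ∑ m ∈ s, a m i x) (fun i j x => ∑ m ∈ s, F m i j x) := by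
  intro i j
  refine (WeakDiv.sum s fun m => h m i j).congr (fun k => Eventually.of_forall fun x => ?_)
    (Eventually.of_forall fun x => rfl)
  simp only [curlField, singleField, Finset.sum_sub_distrib]
  congr 1 <;> split_ifs <;> simp

/-- The pullback of a smooth one-form by a `C¹` map: the first factor of each term
`(b_i ∘ φ) dφ^i` is differentiable, and the second one is curl-free in the weak sense. -/
theorem hasWeakCurl_pullback_of_contDiff (hφ : IsCoordTransformation φ)
    {b : Fin n → Coord n → ℝ} (hb : ∀ i, ContDiff ℝ ∞ (b i)) :
    HasWeakCurl φ.source (fun ρ z => ∑ i, b i (φ z) * jac φ i ρ z)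
      (fun ρ τ z => ∑ i, ∑ j, (pderiv j (b i) (φ z) - pderiv i (b j) (φ z))
        * jac φ i ρ z * jac φ j τ z) := by
  have hO := φ.open_source
  have hbφ : ∀ i, ContDiffOn ℝ 1 (fun z => b i (φ z)) φ.source := fun i =>
    ((hb i).of_le (by norm_cast)).comp_contDiffOn hφ.1
  have hcurl : ∀ i, HasWeakCurl φ.source (fun ρ => jac φ i ρ) (fun _ _ _ => 0) := fun i =>
    hasWeakCurl_pderiv hO (hφ.contDiffOn_coord i)
  have hterm := fun i => (hcurl i).mul_left hO (hbφ i).continuousOn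
    (hasWeakGrad_of_contDiffOn hO (hbφ i))
    (fun k => ((continuousOn_pderiv hO (hbφ i) k).locLp_top.mono_exponent le_top))
    (fun k => (hφ.continuousOn_jac i k).locLp_top.mono_exponent le_top)
  intro ρ τ
  refine ((HasWeakCurl.sum Finset.univ hterm) ρ τ).congr
    (fun k => Eventually.of_forall fun x => rfl) ?_
  filter_upwards [ae_restrict_mem hO.measurableSet] with z hz
  have hp : ∀ i k, pderiv k (fun z => b i (φ z)) z = ∑ j, pderiv j (b i) (φ z) * jac φ j k z :=
    fun i k => hφ.pderiv_comp hz ((hb i).differentiable (by simp) _) k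
  simp only [hp, mul_zero, zero_add, sub_mul, Finset.sum_sub_distrib, Finset.sum_mul]
  congr 1
  · exact Finset.sum_congr rfl fun i _ => Finset.sum_congr rfl fun j _ => by ring
  · rw [Finset.sum_comm]

/-- The weak curl is natural under `C¹` diffeomorphisms: the curl of the pullback of a one-form
is the pullback of its curl. The one-form is mollified to reduce this to the smooth case. -/
theorem HasWeakCurl.pullback (hφ : IsCoordTransformation φ) {a : Fin n → Coord n → ℝ}
    {F : Fin n → Fin n → Coord n → ℝ} (ha : HasWeakCurl φ.target a F)
    (ha1 : ∀ i, LocLp φ.target 1 (a i)) :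
    HasWeakCurl φ.source (fun ρ z => ∑ i, a i (φ z) * jac φ i ρ z)
      (fun ρ τ z => ∑ i, ∑ j, F i j (φ z) * jac φ i ρ z * jac φ j τ z) := by
  have hF1 : ∀ i j, LocLp φ.target 1 (F i j) := fun i j => (ha i j).locG
  have hcomp : ∀ {f : Coord n → ℝ}, LocLp φ.target 1 f → LocLp φ.source 1 fun z => f (φ z) :=
    fun hf => by simpa using hφ.symm.locLp_comp_symm (y := φ.symm) hf
  have hja := hφ.continuousOn_jac
  have hpa : ∀ ρ, LocLp φ.source 1 (fun z => ∑ i, a i (φ z) * jac φ i ρ z) := fun ρ =>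
    LocLp.sum fun i _ => (hcomp (ha1 i)).mul (hja i ρ).locLp_top
  have hpF : ∀ ρ τ, LocLp φ.source 1
      (fun z => ∑ i, ∑ j, F i j (φ z) * jac φ i ρ z * jac φ j τ z) := fun ρ τ =>
    LocLp.sum fun i _ => LocLp.sum fun j _ => LocLp.mul (q₂ := ⊤)
      (LocLp.mul (q := 1) (q₂ := ⊤) (hcomp (hF1 i j)) (hja i ρ).locLp_top) (hja j τ).locLp_top
  intro ρ τ
  refine ⟨locLp_curlField hpa ρ τ, hpF ρ τ, fun ψ hψ => ?_⟩
  simp_rw [sum_curlField_mul _ ρ τ _ fun k => pderiv k ψ _]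
  set S := tsupport ψ
  have hSc : IsCompact S := hψ.2.1
  have hSm := hSc.measurableSet
  have hSs : S ⊆ φ.source := hψ.2.2
  obtain ⟨hS2, hS2t⟩ := isCompact_symm_image (y := φ.symm) hSc hSs
  simp only [OpenPartialHomeomorph.symm_symm, OpenPartialHomeomorph.symm_source] at hS2 hS2t
  obtain ⟨T, hT⟩ := exists_isCollar hS2 φ.open_target hS2t
  obtain ⟨C, hC⟩ := hφ.symm.exists_det_le hS2 hS2t
  have himg : φ.symm '' (φ '' S) = S := image_symm_image (y := φ.symm) hSs
  set μ := (volume : Measure (Coord n)).restrict S with hμ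
  -- `L¹` convergence on `φ '' S` carries over to `S`.
  have hconv : ∀ {f : Coord n → ℝ}, LocLp φ.target 1 f → Tendsto (fun k =>
      eLpNorm (fun z => approx T k f (φ z) - f (φ z)) 1 μ) atTop (𝓝 0) := by
    intro f hf
    have h1 := hT.tendsto_approx hS2.measurableSet le_rfl (by simp) hf
    have h2 := ENNReal.Tendsto.const_mul (a := ENNReal.ofReal C) h1 (Or.inr ENNReal.ofReal_ne_top)
    rw [mul_zero] at h2
    refine tendsto_of_tendsto_of_tendsto_of_le_of_le tendsto_const_nhds h2
      (fun _ => zero_le) fun k => ?_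
    have hm : AEStronglyMeasurable (fun x => approx T k f x - f x)
        (volume.restrict (φ '' S)) :=
      ((hT.contDiff_approx hf k).continuous.aestronglyMeasurable).sub (hf _ hS2 hS2t).1
    have := hφ.symm.eLpNorm_comp_symm_le hS2.measurableSet hS2t hC hm
    rwa [himg] at this
  have happ : ∀ {f : Coord n → ℝ}, LocLp φ.target 1 f → ∀ k,
      MemLp (fun z => approx T k f (φ z)) 1 μ := fun hf k =>
    (((hT.contDiff_approx hf k).continuous.comp_continuousOn φ.continuousOn).locLp_one) S hSc hSs
  have hψc : ContinuousOn ψ φ.source := hψ.1.continuous.continuousOn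
  have hpc : ∀ i, ContinuousOn (pderiv i ψ) φ.source := fun i =>
    (hψ.pderiv i).1.continuous.continuousOn
  -- The coefficients of `a i ∘ φ` and of `F i j ∘ φ` in the identity to be proved.
  set h : Fin n → Coord n → ℝ := fun i z =>
    jac φ i ρ z * pderiv τ ψ z - jac φ i τ z * pderiv ρ ψ z with hh
  set g : Fin n → Fin n → Coord n → ℝ := fun i j z => jac φ i ρ z * jac φ j τ z * ψ z with hg
  have hh1 : ∀ i, MemLp (h i) ⊤ μ := fun i =>
    (((hja i ρ).mul (hpc τ)).sub ((hja i τ).mul (hpc ρ))).locLp_top S hSc hSs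
  have hg1 : ∀ i j, MemLp (g i j) ⊤ μ := fun i j =>
    (((hja i ρ).mul (hja j τ)).mul hψc).locLp_top S hSc hSs
  have hid : ∀ (b : Fin n → ℝ) (G : Fin n → Fin n → ℝ) (z : Coord n),
      ((∑ i, b i * jac φ i ρ z) * pderiv τ ψ z - (∑ i, b i * jac φ i τ z) * pderiv ρ ψ z)
        + (∑ i, ∑ j, G i j * jac φ i ρ z * jac φ j τ z) * ψ z
      = (∑ i, b i * h i z) + ∑ i, ∑ j, G i j * g i j z := by
    intro b G z
    simp only [hh, hg, mul_sub, Finset.sum_sub_distrib, Finset.sum_mul, mul_assoc]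
  have hsplit : ∀ (b : Fin n → Coord n → ℝ) (G : Fin n → Fin n → Coord n → ℝ),
      (∀ i, MemLp (b i) 1 μ) → (∀ i j, MemLp (G i j) 1 μ) →
      ∫ z, (∑ i, b i z * h i z) + ∑ i, ∑ j, G i j z * g i j z ∂μ
        = (∑ i, ∫ z, b i z * h i z ∂μ) + ∑ i, ∑ j, ∫ z, G i j z * g i j z ∂μ := by
    intro b G hb hG
    have i1 : ∀ i, Integrable (fun z => b i z * h i z) μ := fun i =>
      memLp_one_iff_integrable.1 ((hh1 i).mul' (hb i))
    have i2 : ∀ i j, Integrable (fun z => G i j z * g i j z) μ := fun i j =>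
      memLp_one_iff_integrable.1 ((hg1 i j).mul' (hG i j))
    rw [integral_add (integrable_finsetSum _ fun i _ => i1 i)
      (integrable_finsetSum _ fun i _ => integrable_finsetSum _ fun j _ => i2 i j),
      integral_finsetSum _ fun i _ => i1 i,
      integral_finsetSum _ fun i _ => integrable_finsetSum _ fun j _ => i2 i j]
    congr 1
    exact Finset.sum_congr rfl fun i _ => integral_finsetSum _ fun j _ => i2 i j
  have hcompS : ∀ {f : Coord n → ℝ}, LocLp φ.target 1 f → MemLp (fun z => f (φ z)) 1 μ :=
    fun hf => hcomp hf S hSc hSs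
  have hk : ∀ᶠ k in atTop, (∑ i, ∫ z, approx T k (a i) (φ z) * h i z ∂μ)
      + ∑ i, ∑ j, ∫ z, approx T k (F i j) (φ z) * g i j z ∂μ = 0 := by
    filter_upwards [hT.ball_subset] with k hk
    have e := (hasWeakCurl_pullback_of_contDiff hφ fun i => hT.contDiff_approx (ha1 i) k) ρ τ
    have e' := e.integral_eq ψ hψ
    simp_rw [sum_curlField_mul _ ρ τ _ fun k => pderiv k ψ _] at e'
    rw [← hsplit _ _ (fun i => happ (ha1 i) k) (fun i j => happ (hF1 i j) k)]
    refine Eq.trans ?_ e'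
    refine Eq.trans ?_ (setIntegral_eq_integral_of_forall_compl_eq_zero (s := S) ?_)
    · apply setIntegral_congr_fun hSm
      intro z hz
      have hc : ∀ i j, pderiv j (approx T k (a i)) (φ z) - pderiv i (approx T k (a j)) (φ z)
          = approx T k (F i j) (φ z) := fun i j =>
        ha.pderiv_approx ha1 hT (hk _ (mem_image_of_mem φ hz)) i j
      simp only [hc]
      exact (hid _ _ z).symm
    · intro x hx
      simp [image_eq_zero_of_notMem_tsupport hx, pderiv_eq_zero_of_notMem_tsupport _ hx]
  have hlim : Tendsto (fun k => (∑ i, ∫ z, approx T k (a i) (φ z) * h i z ∂μ)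
      + ∑ i, ∑ j, ∫ z, approx T k (F i j) (φ z) * g i j z ∂μ) atTop
      (𝓝 ((∑ i, ∫ z, a i (φ z) * h i z ∂μ) + ∑ i, ∑ j, ∫ z, F i j (φ z) * g i j z ∂μ)) := by
    refine Tendsto.add (tendsto_finsetSum _ fun i _ => ?_)
      (tendsto_finsetSum _ fun i _ => tendsto_finsetSum _ fun j _ => ?_)
    · exact tendsto_integral_mul (q₁ := 1) (q₂ := ⊤) (Eventually.of_forall (happ (ha1 i)))
        (hcompS (ha1 i)) (Eventually.of_forall fun _ => hh1 i) (hh1 i) (hconv (ha1 i))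
        (tendsto_eLpNorm_sub_self _ _ _)
    · exact tendsto_integral_mul (q₁ := 1) (q₂ := ⊤) (Eventually.of_forall (happ (hF1 i j)))
        (hcompS (hF1 i j)) (Eventually.of_forall fun _ => hg1 i j) (hg1 i j) (hconv (hF1 i j))
        (tendsto_eLpNorm_sub_self _ _ _)
  have hfin := tendsto_nhds_unique (hlim.congr' hk) tendsto_const_nhds
  rw [← hfin, ← hsplit _ _ (fun i => hcompS (ha1 i)) (fun i j => hcompS (hF1 i j)),
    ← setIntegral_eq_integral_of_forall_compl_eq_zero (s := S)]
  · congr 1; ext z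
    exact hid _ _ z
  · intro x hx
    simp [image_eq_zero_of_notMem_tsupport hx, pderiv_eq_zero_of_notMem_tsupport _ hx]

end

/-! ### The weak curvature as a weak curl -/

section

variable {Ω : Set (Coord n)} {Γ : ConnectionComponents n} {R : CurvatureComponents n}

theorem locLp_wedge (hΓ : ∀ μ ν ρ, LocLp Ω 2 (Γ μ ν ρ)) (μ ν ρ τ : Fin n) :
    LocLp Ω 1 (wedge Γ μ ν ρ τ) :=
  LocLp.sum fun σ _ => ((hΓ μ σ τ).mul (hΓ σ ν ρ)).sub ((hΓ μ σ ρ).mul (hΓ σ ν τ))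

/-- The weak curvature equation says that the matrix-valued one-form `Γ^μ_{ν ·}` has the weak
curl `R - Γ ∧ Γ`. -/
theorem hasWeakRiem_iff (hΓ : ∀ μ ν ρ, LocLp Ω 2 (Γ μ ν ρ))
    (hR : ∀ μ ν ρ τ, LocLp Ω 1 (R μ ν ρ τ)) :
    HasWeakRiem Ω Γ R ↔ ∀ μ ν, HasWeakCurl Ω (Γ μ ν)
      (fun ρ τ x => R μ ν ρ τ x - wedge Γ μ ν ρ τ x) := by
  have hΓ1 : ∀ μ ν ρ, LocLp Ω 1 (Γ μ ν ρ) := fun μ ν ρ => (hΓ μ ν ρ).mono_exponent (by norm_num)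
  have key : ∀ μ ν ρ τ ψ, IsTestFunction Ω ψ →
      (weakRiem Ω Γ ψ μ ν ρ τ = ∫ x in Ω, R μ ν ρ τ x * ψ x ↔
      ∫ x, ((∑ i, curlField (Γ μ ν) ρ τ i x * pderiv i ψ x)
        + (R μ ν ρ τ x - wedge Γ μ ν ρ τ x) * ψ x) = 0) := by
    intro μ ν ρ τ ψ hψ
    have hz : ∀ x ∉ Ω, ψ x = 0 ∧ ∀ i, pderiv i ψ x = 0 := by
      intro x hx
      have hx' : x ∉ tsupport ψ := fun h => hx (hψ.2.2 h)
      exact ⟨image_eq_zero_of_notMem_tsupport hx',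
        fun i => pderiv_eq_zero_of_notMem_tsupport i hx'⟩
    simp_rw [sum_curlField_mul _ ρ τ _ fun k => pderiv k ψ _, sub_mul (R μ ν ρ τ _)]
    rw [weakRiem,
      setIntegral_eq_integral_of_forall_compl_eq_zero fun x hx => by simp [(hz x hx).2],
      setIntegral_eq_integral_of_forall_compl_eq_zero fun x hx => by simp [(hz x hx).1],
      setIntegral_eq_integral_of_forall_compl_eq_zero fun x hx => by simp [(hz x hx).1]]
    have i1 : Integrable fun x => Γ μ ν ρ x * pderiv τ ψ x - Γ μ ν τ x * pderiv ρ ψ x :=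
      ((hΓ1 μ ν ρ).integrable_mul_test (hψ.pderiv τ)).sub
        ((hΓ1 μ ν τ).integrable_mul_test (hψ.pderiv ρ))
    have i2 := (hR μ ν ρ τ).integrable_mul_test hψ
    have i3 := (locLp_wedge hΓ μ ν ρ τ).integrable_mul_test hψ
    have i4 : Integrable fun x => R μ ν ρ τ x * ψ x - wedge Γ μ ν ρ τ x * ψ x := i2.sub i3
    rw [integral_add i1 i4, integral_sub i2 i3]
    constructor <;> intro h <;> linarith
  constructor
  · intro h μ ν ρ τ
    exact ⟨locLp_curlField (hΓ1 μ ν) ρ τ, (hR μ ν ρ τ).sub (locLp_wedge hΓ μ ν ρ τ),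
      fun ψ hψ => (key μ ν ρ τ ψ hψ).1 (h ψ hψ μ ν ρ τ)⟩
  · intro h ψ hψ μ ν ρ τ
    exact (key μ ν ρ τ ψ hψ).2 ((h μ ν ρ τ).integral_eq ψ hψ)

theorem HasWeakCurl.sub {a b : Fin n → Coord n → ℝ} {F H : Fin n → Fin n → Coord n → ℝ}
    (ha : HasWeakCurl Ω a F) (hb : HasWeakCurl Ω b H) :
    HasWeakCurl Ω (fun i x => a i x - b i x) (fun i j x => F i j x - H i j x) := by
  intro i j
  refine ((ha i j).sub (hb i j)).congr (fun k => Eventually.of_forall fun x => ?_)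
    (Eventually.of_forall fun x => rfl)
  simp only [curlField, singleField]
  split_ifs <;> ring

theorem HasWeakCurl.congr {a b : Fin n → Coord n → ℝ} {F H : Fin n → Fin n → Coord n → ℝ}
    (ha : HasWeakCurl Ω a F) (h : ∀ i, ∀ᵐ x ∂volume.restrict Ω, a i x = b i x)
    (h' : ∀ i j, ∀ᵐ x ∂volume.restrict Ω, F i j x = H i j x) : HasWeakCurl Ω b H := by
  intro i j
  refine (ha i j).congr (fun k => ?_) (h' i j)
  filter_upwards [h i, h j] with x hi hj
  simp only [curlField, singleField, hi, hj]

theorem hasWeakGrad_of_hasWeakPDeriv {u : Coord n → ℝ} {du : Fin n → Coord n → ℝ}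
    (hu : LocLp Ω 1 u) (hdu : ∀ i, LocLp Ω 1 (du i)) (h : ∀ i, HasWeakPDeriv Ω i u (du i)) :
    HasWeakGrad Ω u du := by
  intro i
  refine ⟨fun k => hu.singleField i k, hdu i, fun ψ hψ => ?_⟩
  simp_rw [sum_singleField_mul i u _ fun k => pderiv k ψ _]
  rw [integral_add (hu.integrable_mul_test (hψ.pderiv i)) ((hdu i).integrable_mul_test hψ)]
  have hx : ∀ x ∉ Ω, x ∉ tsupport ψ := fun x hx h => hx (hψ.2.2 h)
  have e := h i ψ hψ
  rw [setIntegral_eq_integral_of_forall_compl_eq_zero fun x h => by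
      simp [pderiv_eq_zero_of_notMem_tsupport i (hx x h)],
    setIntegral_eq_integral_of_forall_compl_eq_zero fun x h => by
      simp [image_eq_zero_of_notMem_tsupport (hx x h)]] at e
  linarith

end

/-! ### Index algebra of the transformation laws -/

section

variable {ι : Type*} [Fintype ι] [DecidableEq ι]

theorem sum_mul_sum_of_inverse {A B : ι → ι → ℝ}
    (h : ∀ a c, ∑ b, A a b * B b c = if a = c then 1 else 0) (f : ι → ℝ) (a : ι) :
    ∑ b, A a b * ∑ c, B b c * f c = f a := by
  simp only [Finset.mul_sum]
  rw [Finset.sum_comm]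
  simp only [← mul_assoc, ← Finset.sum_mul, h]
  simp

/-- The inverse of the transformation law of a tensor of type `(1,3)`. -/
theorem tensor_law_inverse {J K : ι → ι → ℝ}
    (hJK : ∀ a c, ∑ b, J a b * K b c = if a = c then 1 else 0) {R S : ι → ι → ι → ι → ℝ}
    (hR : ∀ τ μ ν ρ, R τ μ ν ρ = ∑ δ, ∑ α, ∑ β, ∑ γ,
      K τ δ * J α μ * J β ν * J γ ρ * S δ α β γ) (δ α β γ : ι) :
    S δ α β γ = ∑ τ, ∑ μ, ∑ ν, ∑ ρ, J δ τ * K μ α * K ν β * K ρ γ * R τ μ ν ρ := by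
  have hT : ∀ a c, ∑ b, K b a * J c b = if a = c then 1 else 0 := fun a c => by
    simp only [mul_comm (K _ a), hJK, eq_comm]
  have e : ∀ τ μ ν ρ, R τ μ ν ρ =
      ∑ δ, K τ δ * ∑ α, J α μ * ∑ β, J β ν * ∑ γ, J γ ρ * S δ α β γ := by
    intro τ μ ν ρ
    simp only [hR, Finset.mul_sum, mul_assoc]
  have e2 : ∀ (δ α β γ : ι), ∑ τ, ∑ μ, ∑ ν, ∑ ρ, J δ τ * K μ α * K ν β * K ρ γ * R τ μ ν ρ
      = ∑ ρ, K ρ γ * ∑ ν, K ν β * ∑ μ, K μ α * ∑ τ, J δ τ * R τ μ ν ρ := by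
    intro δ α β γ
    simp only [Finset.mul_sum]
    rw [Finset.sum_comm]
    refine Eq.trans (Finset.sum_congr rfl fun μ _ => Finset.sum_comm) ?_
    rw [Finset.sum_comm]
    refine Eq.trans (Finset.sum_congr rfl fun ν _ => Finset.sum_congr rfl fun μ _ =>
      Finset.sum_comm) ?_
    refine Eq.trans (Finset.sum_congr rfl fun ν _ => Finset.sum_comm) ?_
    rw [Finset.sum_comm]
    refine Finset.sum_congr rfl fun ρ _ => Finset.sum_congr rfl fun ν _ =>
      Finset.sum_congr rfl fun μ _ => Finset.sum_congr rfl fun τ _ => by ring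
  rw [e2]
  simp only [e, sum_mul_sum_of_inverse hJK]
  simp only [sum_mul_sum_of_inverse (A := fun a b => K b a) (B := fun b c => J c b) hT]

/-- The curvature of the transformed connection `(J ω - D) K`: here `ws`, `wt`, `Ds`, `Dt` are
the components of `ω` and `D = dJ` in two directions, `R` is the curvature component of `ω`, and
the left-hand side is the curl computed by the product rule. -/
theorem gauge_curl_identity {J K R ws wt Ds Dt : Matrix ι ι ℝ} (hKJ : K * J = 1) :
    (J * (R - (wt * ws - ws * wt)) + (Dt * ws - Ds * wt)) * K
      + ((J * ws - Ds) * -(K * Dt * K) - (J * wt - Dt) * -(K * Ds * K))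
    = J * R * K - ((J * wt - Dt) * K * ((J * ws - Ds) * K)
      - (J * ws - Ds) * K * ((J * wt - Dt) * K)) := by
  have h : ∀ w D : Matrix ι ι ℝ, K * ((J * w - D) * K) = w * K - K * D * K := by
    intro w D
    rw [sub_mul, mul_sub, ← mul_assoc, ← mul_assoc, hKJ, one_mul, ← mul_assoc]
  rw [mul_assoc (J * wt - Dt) K, mul_assoc (J * ws - Ds) K, h, h]
  noncomm_ring

end

/-! ### Transformation of the weak curvature -/

section

variable {y : OpenPartialHomeomorph (Coord n) (Coord n)}
  {dJ : Fin n → Fin n → Fin n → Coord n → ℝ} {Γx Γy : ConnectionComponents n}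
  {Rx Ry : CurvatureComponents n}

/-- Second weak derivatives of a coordinate transformation are symmetric. -/
theorem IsCoordTransformation.ae_symm (hy : IsCoordTransformation y)
    (hdJ : ∀ α ν, HasWeakGrad y.source (jac y α ν) (dJ α ν)) (α μ ν : Fin n) :
    ∀ᵐ x ∂volume.restrict y.source, dJ α μ ν x = dJ α ν μ x := by
  have h0 := hasWeakCurl_pderiv y.open_source (hy.contDiffOn_coord α) μ ν
  have h1 : WeakDiv y.source (curlField (fun i => pderiv i fun x => y x α) μ ν)
      (fun x => dJ α μ ν x - dJ α ν μ x) := (hdJ α μ ν).sub (hdJ α ν μ)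
  filter_upwards [h1.ae_unique y.open_source h0] with x hx using sub_eq_zero.1 hx

/-- The connection law solved for the pulled-back connection plus the derivative of the
Jacobian. -/
theorem IsCoordTransformation.ae_connectionLaw (hy : IsCoordTransformation y)
    (hΓ : ConnectionLaw y dJ Γx Γy) :
    ∀ᵐ x ∂volume.restrict y.source, ∀ α ρ ν, ∑ μ, jac y α μ x * Γx μ ρ ν x
      = (∑ β, ∑ γ, jac y β ρ x * jac y γ ν x * Γy α β γ (y x)) + dJ α ν ρ x := by
  have h : ∀ᵐ x ∂volume.restrict y.source, ∀ μ ρ ν, Γx μ ρ ν x = ∑ α, invJac y μ α x *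
      ((∑ β, ∑ γ, jac y β ρ x * jac y γ ν x * Γy α β γ (y x)) + dJ α ν ρ x) := by
    simp only [ae_all_iff]
    exact hΓ
  filter_upwards [h, ae_restrict_mem y.open_source.measurableSet] with x hx hxs α ρ ν
  simp only [hx]
  exact sum_mul_sum_of_inverse (A := fun a b => jac y a b x) (B := fun b c => invJac y b c x)
    (hy.sum_jac_mul_invJac hxs) _ α

theorem IsCoordTransformation.locLp_comp (hy : IsCoordTransformation y) {q : ℝ≥0∞}
    {f : Coord n → ℝ} (hf : LocLp y.target q f) : LocLp y.source q fun x => f (y x) := by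
  simpa using hy.symm.locLp_comp_symm (y := y.symm) hf

/-- The second derivatives of the transformation inherit the local integrability of the
connections. -/
theorem IsCoordTransformation.locLp_dJ (hy : IsCoordTransformation y)
    (hΓx : ∀ μ ρ ν, LocLp y.source 2 (Γx μ ρ ν)) (hΓy : ∀ α β γ, LocLp y.target 2 (Γy α β γ))
    (hΓ : ConnectionLaw y dJ Γx Γy) (α ν ρ : Fin n) : LocLp y.source 2 (dJ α ν ρ) := by
  have hJ := fun α μ => (hy.continuousOn_jac α μ).locLp_top
  have h1 : LocLp y.source 2 fun x => (∑ μ, jac y α μ x * Γx μ ρ ν x)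
      - ∑ β, ∑ γ, jac y β ρ x * jac y γ ν x * Γy α β γ (y x) :=
    (LocLp.sum fun μ _ => (hJ α μ).mul (hΓx μ ρ ν)).sub
      (LocLp.sum fun β _ => LocLp.sum fun γ _ => LocLp.mul (q₁ := ⊤)
        (LocLp.mul (q₁ := ⊤) (q₂ := ⊤) (hJ β ρ) (hJ γ ν)) (hy.locLp_comp (hΓy α β γ)))
  refine h1.congr ?_
  filter_upwards [hy.ae_connectionLaw hΓ] with x hx
  rw [hx]; ring

/-- The tensor law solved for the transformed tensor, in terms of the new coordinates. -/
theorem IsCoordTransformation.ae_tensorLaw (hy : IsCoordTransformation y)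
    (hR : TensorLaw y Rx Ry) :
    ∀ᵐ z ∂volume.restrict y.target, ∀ δ α β γ, Ry δ α β γ z = ∑ τ, ∑ μ, ∑ ν, ∑ ρ,
      jac y δ τ (y.symm z) * invJac y μ α (y.symm z) * invJac y ν β (y.symm z)
        * invJac y ρ γ (y.symm z) * Rx τ μ ν ρ (y.symm z) := by
  have h : ∀ᵐ x ∂volume.restrict y.source, ∀ τ μ ν ρ, Rx τ μ ν ρ x = ∑ δ, ∑ α, ∑ β, ∑ γ,
      invJac y τ δ x * jac y α μ x * jac y β ν x * jac y γ ρ x * Ry δ α β γ (y x) := by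
    simp only [ae_all_iff]
    exact hR
  filter_upwards [hy.ae_comp_symm h, ae_restrict_mem y.open_target.measurableSet]
    with z hz hzt δ α β γ
  have := tensor_law_inverse (J := fun a b => jac y a b (y.symm z))
    (K := fun a b => invJac y a b (y.symm z)) (hy.sum_jac_mul_invJac (y.map_target hzt)) hz δ α β γ
  simpa only [y.right_inv hzt] using this

theorem IsCoordTransformation.locLp_of_tensorLaw (hy : IsCoordTransformation y)
    (hR : TensorLaw y Rx Ry) {q : ℝ≥0∞} (hRx : ∀ τ μ ν ρ, LocLp y.source q (Rx τ μ ν ρ))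
    (δ α β γ : Fin n) : LocLp y.target q (Ry δ α β γ) := by
  have hJ := fun α μ => hy.continuousOn_jac α μ
  have hK := fun α μ => hy.continuousOn_invJac α μ
  have h1 : LocLp y.source q fun x => ∑ τ, ∑ μ, ∑ ν, ∑ ρ,
      jac y δ τ x * invJac y μ α x * invJac y ν β x * invJac y ρ γ x * Rx τ μ ν ρ x :=
    LocLp.sum fun τ _ => LocLp.sum fun μ _ => LocLp.sum fun ν _ => LocLp.sum fun ρ _ =>
      ((((hJ δ τ).mul (hK μ α)).mul (hK ν β)).mul (hK ρ γ)).locLp_top.mul (hRx τ μ ν ρ)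
  refine (hy.locLp_comp_symm h1).congr ?_
  filter_upwards [hy.ae_tensorLaw hR] with z hz
  exact (hz δ α β γ).symm

/-- The curl of the pulled-back connection `B = (J ω - dJ) J⁻¹` on the source, in terms of the
curvature of `ω`. -/
theorem hasWeakCurl_gauge (hy : IsCoordTransformation y)
    (hdJ : ∀ α ν, HasWeakGrad y.source (jac y α ν) (dJ α ν))
    (hdJ2 : ∀ α ν i, LocLp y.source 2 (dJ α ν i))
    (hΓx : ∀ μ ρ ν, LocLp y.source 2 (Γx μ ρ ν))
    (hcurl : ∀ μ ρ, HasWeakCurl y.source (Γx μ ρ)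
      (fun σ τ x => Rx μ ρ σ τ x - wedge Γx μ ρ σ τ x))
    {B : Fin n → Fin n → Fin n → Coord n → ℝ}
    (hB : ∀ α β ν, B α β ν = fun x => ∑ ρ, invJac y ρ β x *
      ((∑ μ, jac y α μ x * Γx μ ρ ν x) - dJ α ρ ν x)) (α β : Fin n) :
    HasWeakCurl y.source (B α β) (fun σ τ x =>
      (∑ ρ, ∑ μ, jac y α μ x * Rx μ ρ σ τ x * invJac y ρ β x)
        - ∑ l, (B α l τ x * B l β σ x - B α l σ x * B l β τ x)) := by
  have hO := y.open_source
  have hJc := hy.continuousOn_jac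
  set A : Coord n → Matrix (Fin n) (Fin n) ℝ := fun x => Matrix.of fun a b => jac y a b x with hA
  set K : Coord n → Matrix (Fin n) (Fin n) ℝ := fun x => Matrix.of fun a b => invJac y a b x
    with hK
  have hAK : ∀ x ∈ y.source, A x * K x = 1 := by
    intro x hx
    ext a b
    simp only [Matrix.mul_apply, hA, hK, Matrix.of_apply, Matrix.one_apply]
    exact hy.sum_jac_mul_invJac hx a b
  obtain ⟨hKc, hdK, hdK2⟩ := hasWeakGrad_of_mul_eq_one (A := A) (B := K) hO
    (fun i j => hJc i j) hdJ hdJ2 hAK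
  have hC2 : ∀ ρ ν, LocLp y.source 2 fun x => (∑ μ, jac y α μ x * Γx μ ρ ν x) - dJ α ρ ν x :=
    fun ρ ν => (LocLp.sum fun μ _ => (hJc α μ).locLp_top.mul (hΓx μ ρ ν)).sub (hdJ2 α ρ ν)
  have hC := fun ρ => (HasWeakCurl.sum Finset.univ fun μ =>
    (hcurl μ ρ).mul_left hO (hJc α μ) (hdJ α μ) (hdJ2 α μ) (hΓx μ ρ)).sub
      (hdJ α ρ).hasWeakCurl
  have hB' := HasWeakCurl.sum Finset.univ fun ρ =>
    (hC ρ).mul_left hO (hKc ρ β) (hdK ρ β) (hdK2 ρ β) (hC2 ρ)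
  refine hB'.congr (fun ν => Eventually.of_forall fun x => by rw [hB]; rfl) fun σ τ => ?_
  filter_upwards [ae_restrict_mem hO.measurableSet] with x hx
  have hKA : K x * A x = 1 := mul_eq_one_comm.1 (hAK x hx)
  -- The matrices of the components of the connection and of the derivative of the Jacobian.
  set w : Fin n → Matrix (Fin n) (Fin n) ℝ := fun s => Matrix.of fun a b => Γx a b s x with hw
  set D : Fin n → Matrix (Fin n) (Fin n) ℝ := fun s => Matrix.of fun a b => dJ a b s x with hD
  set R : Matrix (Fin n) (Fin n) ℝ := Matrix.of fun a b => Rx a b σ τ x with hRdef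
  have key := congrFun (congrFun (gauge_curl_identity (R := R) (ws := w σ) (wt := w τ)
    (Ds := D σ) (Dt := D τ) hKA) α) β
  have eC : ∀ s a b, (A x * w s - D s) a b = (∑ μ, jac y a μ x * Γx μ b s x) - dJ a b s x :=
    fun s a b => by simp [Matrix.mul_apply, hA, hw, hD]
  have eB : ∀ s a b, ((A x * w s - D s) * K x) a b = B a b s x := by
    intro s a b
    rw [hB, Matrix.mul_apply]
    exact Finset.sum_congr rfl fun ρ _ => by rw [eC, mul_comm]; rfl
  have edK : ∀ s a b, (-(K x * D s * K x)) a b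
      = -∑ i, ∑ j, K x a i * dJ i j s x * K x j b := by
    intro s a b
    rw [Matrix.neg_apply, Matrix.mul_apply, Finset.sum_comm]
    congr 1
    refine Finset.sum_congr rfl fun j _ => ?_
    rw [Matrix.mul_apply, Finset.sum_mul]
    rfl
  have ew : ∀ a b, (w τ * w σ - w σ * w τ) a b = wedge Γx a b σ τ x := by
    intro a b
    simp [wedge, Matrix.mul_apply, hw, Finset.sum_sub_distrib]
  have eF : ∀ b, (A x * (R - (w τ * w σ - w σ * w τ)) + (D τ * w σ - D σ * w τ)) α b
      = (∑ μ, (jac y α μ x * (Rx μ b σ τ x - wedge Γx μ b σ τ x)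
        + (dJ α μ τ x * Γx μ b σ x - dJ α μ σ x * Γx μ b τ x))) - 0 := by
    intro b
    rw [sub_zero, Matrix.add_apply, Matrix.mul_apply, Finset.sum_add_distrib]
    congr 1
    · exact Finset.sum_congr rfl fun μ _ => by rw [Matrix.sub_apply, ew]; rfl
    · simp [Matrix.mul_apply, hw, hD, Finset.sum_sub_distrib]
  have eR : (A x * R * K x) α β = ∑ ρ, ∑ μ, jac y α μ x * Rx μ ρ σ τ x * invJac y ρ β x := by
    rw [Matrix.mul_apply]
    refine Finset.sum_congr rfl fun ρ _ => ?_
    rw [Matrix.mul_apply, Finset.sum_mul]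
    rfl
  rw [Matrix.sub_apply (A x * R * K x), eR, Matrix.sub_apply (_ * _ * (_ * _)),
    Matrix.mul_apply (M := (A x * w τ - D τ) * K x),
    Matrix.mul_apply (M := (A x * w σ - D σ) * K x), ← Finset.sum_sub_distrib] at key
  simp only [eB] at key
  rw [← key, Matrix.add_apply, Matrix.sub_apply (_ * -_), Matrix.mul_apply,
    Matrix.mul_apply (N := -(K x * D τ * K x)), Matrix.mul_apply (N := -(K x * D σ * K x)),
    ← Finset.sum_sub_distrib, ← Finset.sum_add_distrib]
  refine Finset.sum_congr rfl fun ρ _ => ?_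
  rw [eF, eC, eC, edK, edK]
  ring

theorem sum_comm_rotate {ι : Type*} [Fintype ι] (f : ι → ι → ι → ι → ℝ) :
    ∑ a, ∑ b, ∑ c, ∑ d, f a b c d = ∑ d, ∑ c, ∑ a, ∑ b, f a b c d := by
  have h : ∀ g : ι → ι → ι → ℝ, ∑ a, ∑ b, ∑ c, g a b c = ∑ c, ∑ a, ∑ b, g a b c := fun g =>
    (Finset.sum_congr rfl fun a _ => Finset.sum_comm).trans Finset.sum_comm
  refine (Finset.sum_congr rfl fun a _ => h (f a)).trans ?_
  rw [Finset.sum_comm]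
  exact Finset.sum_congr rfl fun d _ => h fun a b c => f a b c d

theorem sum_sum_mul_mul_mul {ι : Type*} [Fintype ι] (p q : ι → ι → ℝ) (u v : ι → ℝ) :
    ∑ a, ∑ b, (∑ l, p l b * q l a) * u a * v b
      = ∑ l, (∑ b, p l b * v b) * ∑ a, q l a * u a := by
  simp only [Finset.sum_mul]
  refine (Finset.sum_congr rfl fun a _ => Finset.sum_comm).trans ?_
  rw [Finset.sum_comm]
  refine Finset.sum_congr rfl fun l _ => ?_
  rw [Finset.sum_comm]
  refine Finset.sum_congr rfl fun b _ => ?_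
  rw [Finset.mul_sum]
  exact Finset.sum_congr rfl fun a _ => by ring

/-- The weak curvature equation transforms as a tensor equation. -/
theorem IsCoordTransformation.hasWeakRiem (hy : IsCoordTransformation y)
    (hdJ : ∀ α ν, HasWeakGrad y.source (jac y α ν) (dJ α ν))
    (hΓx : ∀ μ ρ ν, LocLp y.source 2 (Γx μ ρ ν)) (hΓy : ∀ α β γ, LocLp y.target 2 (Γy α β γ))
    (hΓ : ConnectionLaw y dJ Γx Γy) (hRx : ∀ τ μ ν ρ, LocLp y.source 1 (Rx τ μ ν ρ))
    (hRiem : HasWeakRiem y.source Γx Rx) (hR : TensorLaw y Rx Ry) :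
    HasWeakRiem y.target Γy Ry := by
  have hdJ2 := hy.locLp_dJ hΓx hΓy hΓ
  have hsymm : ∀ᵐ x ∂volume.restrict y.source, ∀ α μ ν, dJ α μ ν x = dJ α ν μ x := by
    simp only [ae_all_iff]
    exact hy.ae_symm hdJ
  rw [hasWeakRiem_iff hΓy (hy.locLp_of_tensorLaw hR hRx)]
  rw [hasWeakRiem_iff hΓx hRx] at hRiem
  set B : Fin n → Fin n → Fin n → Coord n → ℝ := fun α β ν x => ∑ ρ, invJac y ρ β x *
      ((∑ μ, jac y α μ x * Γx μ ρ ν x) - dJ α ρ ν x) with hB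
  intro α β
  have hgauge := hasWeakCurl_gauge hy hdJ hdJ2 hΓx hRiem (B := B) (fun _ _ _ => rfl) α β
  have hB2 : ∀ ν, LocLp y.source 2 (B α β ν) := fun ν => LocLp.sum fun ρ _ =>
    (hy.continuousOn_invJac ρ β).locLp_top.mul
      ((LocLp.sum fun μ _ => (hy.continuousOn_jac α μ).locLp_top.mul (hΓx μ ρ ν)).sub
        (hdJ2 α ρ ν))
  have hpull := HasWeakCurl.pullback (φ := y.symm) hy.symm (a := B α β)
    (by simpa using hgauge) (fun ν => by simpa using (hB2 ν).mono_exponent (by norm_num))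
  rw [OpenPartialHomeomorph.symm_source] at hpull
  -- The form `B` is the pullback of the connection `Γy`.
  have hBae : ∀ᵐ x ∂volume.restrict y.source, ∀ α β ν,
      B α β ν x = ∑ γ, jac y γ ν x * Γy α β γ (y x) := by
    filter_upwards [hy.ae_connectionLaw hΓ, hsymm, ae_restrict_mem y.open_source.measurableSet]
      with x hx hs hxs α β ν
    have e : ∀ ρ, (∑ μ, jac y α μ x * Γx μ ρ ν x) - dJ α ρ ν x
        = ∑ b, jac y b ρ x * ∑ γ, jac y γ ν x * Γy α b γ (y x) := by
      intro ρ
      rw [hx, hs α ν ρ, add_sub_cancel_right]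
      exact Finset.sum_congr rfl fun b _ => by
        rw [Finset.mul_sum]; exact Finset.sum_congr rfl fun γ _ => by ring
    simp only [hB, e]
    refine sum_mul_sum_of_inverse (A := fun a b => invJac y b a x) (B := fun b c => jac y c b x)
      (fun a c => ?_) _ β
    simp only [mul_comm (invJac y _ a x), hy.sum_jac_mul_invJac hxs, eq_comm]
  have hΓae : ∀ᵐ z ∂volume.restrict y.target, ∀ α β γ,
      ∑ ν, B α β ν (y.symm z) * jac y.symm ν γ z = Γy α β γ z := by
    filter_upwards [hy.ae_comp_symm hBae, ae_restrict_mem y.open_target.measurableSet]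
      with z hz hzt α β γ
    simp only [hz, y.right_inv hzt, ← invJac_symm_apply hzt]
    simp only [mul_comm _ (invJac y _ γ (y.symm z))]
    refine sum_mul_sum_of_inverse (A := fun a b => invJac y b a (y.symm z))
      (B := fun b c => jac y c b (y.symm z)) (fun a c => ?_) _ γ
    simp only [mul_comm (invJac y _ a _), hy.sum_jac_mul_invJac (y.map_target hzt), eq_comm]
  refine hpull.congr (fun γ => hΓae.mono fun z hz => hz α β γ) fun σ' τ' => ?_
  filter_upwards [hΓae, hy.ae_tensorLaw hR, ae_restrict_mem y.open_target.measurableSet]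
    with z hz hRz hzt
  simp only [sub_mul, Finset.sum_sub_distrib]
  congr 1
  · simp only [hRz, invJac_symm_apply hzt, Finset.sum_mul]
    rw [sum_comm_rotate]
    exact Finset.sum_congr rfl fun τ _ => Finset.sum_congr rfl fun μ _ =>
      Finset.sum_congr rfl fun ν _ => Finset.sum_congr rfl fun ρ _ => by ring
  · rw [wedge, Finset.sum_sub_distrib]
    simp only [← hz]
    congr 1
    · exact sum_sum_mul_mul_mul (fun l b => B α l b (y.symm z)) (fun l a => B l β a (y.symm z)) _ _
    · rw [Finset.sum_comm]
      refine Eq.trans ?_ (sum_sum_mul_mul_mul (fun l b => B α l b (y.symm z))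
        (fun l a => B l β a (y.symm z)) (fun a => jac y.symm a τ' z) fun b => jac y.symm b σ' z)
      exact Finset.sum_congr rfl fun a _ => Finset.sum_congr rfl fun b _ => by ring

end

/-! ### Boundedness of Sobolev functions under the cone condition -/

/-- The fundamental theorem of calculus along the segment from `x` to `x + w`. -/
theorem enorm_le_enorm_add_lintegral {f : Coord n → ℝ} (hf : ContDiff ℝ ∞ f) (x w : Coord n)
    {h : ℝ} (hw : ‖w‖ ≤ h) :
    ‖f x‖ₑ ≤ ‖f (x + w)‖ₑ
      + ∫⁻ t in Ioc (0 : ℝ) 1, ∑ i, ENNReal.ofReal h * ‖pderiv i f (x + t • w)‖ₑ := by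
  have hd : ∀ t : ℝ, HasDerivAt (fun t : ℝ => f (x + t • w))
      (∑ i, pderiv i f (x + t • w) * w i) t := by
    intro t
    have h1 : HasDerivAt (fun t : ℝ => x + t • w) w t := by
      simpa using ((hasDerivAt_id t).smul_const w).const_add x
    have h2 := ((hf.differentiable (by simp)) (x + t • w)).hasFDerivAt.comp_hasDerivAt t h1
    rw [clm_apply_eq_sum] at h2
    exact h2
  have hcont : Continuous fun t : ℝ => ∑ i, pderiv i f (x + t • w) * w i := by
    refine continuous_finsetSum _ fun i _ => ?_
    exact ((contDiff_pderiv hf i).continuous.comp (by fun_prop)).mul continuous_const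
  have hftc := intervalIntegral.integral_eq_sub_of_hasDerivAt (a := 0) (b := 1)
    (fun t _ => hd t) (hcont.intervalIntegrable _ _)
  rw [intervalIntegral.integral_of_le zero_le_one] at hftc
  simp only [one_smul, zero_smul, add_zero] at hftc
  have e : f x = f (x + w) - ∫ t in Ioc (0 : ℝ) 1, ∑ i, pderiv i f (x + t • w) * w i := by
    rw [hftc]; ring
  have h0 : 0 ≤ h := (norm_nonneg w).trans hw
  calc ‖f x‖ₑ ≤ ‖f (x + w)‖ₑ
        + ‖∫ t in Ioc (0 : ℝ) 1, ∑ i, pderiv i f (x + t • w) * w i‖ₑ := by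
        conv_lhs => rw [e]
        exact enorm_sub_le
    _ ≤ _ := by
        refine add_le_add le_rfl ((enorm_integral_le_lintegral_enorm _).trans
          (lintegral_mono fun t => (enorm_sum_le _ _).trans (Finset.sum_le_sum fun i _ => ?_)))
        rw [enorm_mul, mul_comm]
        refine mul_le_mul_left ?_ _
        rw [← ofReal_norm]
        exact ENNReal.ofReal_le_ofReal ((PiLp.norm_apply_le w i).trans hw)

/-- Averages over a rescaled set: Hölder's inequality and the change of variables
`w ↦ x + t w`, whose Jacobian produces the factor `t ^ (-n / p)`. -/
theorem lintegral_enorm_comp_le {g : Coord n → ℝ} (hg : Continuous g) {p : ℝ} (hp : 1 ≤ p)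
    {B S : Set (Coord n)} (hS : MeasurableSet S) {x : Coord n} {t : ℝ}
    (ht : 0 < t) (hBS : ∀ w ∈ B, x + t • w ∈ S) (hB : MeasurableSet B) :
    ∫⁻ w in B, ‖g (x + t • w)‖ₑ ≤ ENNReal.ofReal (t ^ (-(n : ℝ) / p))
      * (eLpNorm g (ENNReal.ofReal p) (volume.restrict S) * volume B ^ (1 - 1 / p)) := by
  have hp0 : 0 < p := by linarith
  set θ : Coord n → Coord n := fun w => x + t • w with hθ
  have hθc : Continuous θ := by fun_prop
  have hmap : Measure.map θ (volume.restrict B)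
      ≤ ENNReal.ofReal (t ^ (-(n : ℝ))) • volume.restrict S := by
    refine Measure.le_iff.2 fun A hA => ?_
    rw [Measure.map_apply hθc.measurable hA, Measure.restrict_apply' hB, Measure.smul_apply,
      Measure.restrict_apply' hS, smul_eq_mul]
    calc volume (θ ⁻¹' A ∩ B) ≤ volume ((t • ·) ⁻¹' ((x + ·) ⁻¹' (A ∩ S))) :=
          measure_mono fun w hw => ⟨hw.1, hBS w hw.2⟩
      _ = _ := by
          rw [Measure.addHaar_preimage_smul _ ht.ne', measure_preimage_add, finrank_euclideanSpace,
            Fintype.card_fin, abs_of_pos (by positivity), Real.rpow_neg ht.le, Real.rpow_natCast]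
  have h1 := eLpNorm_le_eLpNorm_mul_rpow_measure_univ (μ := volume.restrict B)
    (p := 1) (q := ENNReal.ofReal p) (f := fun w => g (θ w))
    (by rw [← ENNReal.ofReal_one]; exact ENNReal.ofReal_le_ofReal hp)
    (hg.comp hθc).aestronglyMeasurable
  rw [eLpNorm_one_eq_lintegral_enorm, Measure.restrict_apply_univ, ENNReal.toReal_one,
    ENNReal.toReal_ofReal hp0.le, one_div_one] at h1
  refine h1.trans ?_
  rw [← mul_assoc]
  refine mul_le_mul_left ?_ _
  have h2 := eLpNorm_map_measure (p := ENNReal.ofReal p) (μ := volume.restrict B) (f := θ) (g := g)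
    hg.aestronglyMeasurable hθc.measurable.aemeasurable
  have h3 : eLpNorm (fun w => g (θ w)) (ENNReal.ofReal p) (volume.restrict B)
      ≤ eLpNorm g (ENNReal.ofReal p) (ENNReal.ofReal (t ^ (-(n : ℝ))) • volume.restrict S) := by
    refine le_trans (le_of_eq h2.symm) (eLpNorm_mono_measure _ hmap)
  refine h3.trans (le_of_eq ?_)
  rw [eLpNorm_smul_measure_of_ne_top ENNReal.ofReal_ne_top, smul_eq_mul, ENNReal.toReal_div,
    ENNReal.toReal_one,
    ENNReal.toReal_ofReal hp0.le, ENNReal.ofReal_rpow_of_pos (by positivity), ← Real.rpow_mul ht.le]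
  congr 3
  ring

/-- The estimate `lintegral_enorm_comp_le` integrated over the segments from `x` to the points of
`x + B`. -/
theorem lintegral_lintegral_sum_le {g : Fin n → Coord n → ℝ} (hg : ∀ i, Continuous (g i)) {p : ℝ}
    (hp : 1 ≤ p) {B S : Set (Coord n)} (hB : MeasurableSet B) (hS : MeasurableSet S) {x : Coord n}
    (hBS : ∀ w ∈ B, ∀ t ∈ Ioc (0 : ℝ) 1, x + t • w ∈ S) (a : ℝ≥0∞) :
    ∫⁻ w in B, ∫⁻ t in Ioc (0 : ℝ) 1, ∑ i, a * ‖g i (x + t • w)‖ₑ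
      ≤ ∫⁻ t in Ioc (0 : ℝ) 1, ENNReal.ofReal (t ^ (-(n : ℝ) / p)) * (∑ i, a *
        (eLpNorm (g i) (ENNReal.ofReal p) (volume.restrict S) * volume B ^ (1 - 1 / p))) := by
  have hmeas : ∀ i, Measurable fun z : Coord n × ℝ => ‖g i (x + z.2 • z.1)‖ₑ := fun i =>
    ((hg i).comp (by fun_prop : Continuous fun z : Coord n × ℝ => x + z.2 • z.1)).enorm.measurable
  have hterm : ∀ i, Measurable fun z : Coord n × ℝ => a * ‖g i (x + z.2 • z.1)‖ₑ := fun i =>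
    (hmeas i).const_mul a
  have hsum : Measurable fun z : Coord n × ℝ => ∑ i, a * ‖g i (x + z.2 • z.1)‖ₑ :=
    Finset.measurable_sum Finset.univ fun i _ => hterm i
  rw [lintegral_lintegral_swap hsum.aemeasurable]
  refine setLIntegral_mono' measurableSet_Ioc fun t ht => ?_
  have hm : ∀ i, Measurable fun w => ‖g i (x + t • w)‖ₑ := fun i =>
    (hmeas i).comp (by fun_prop : Measurable fun w : Coord n => (w, t))
  rw [lintegral_finsetSum _ fun i _ => (hm i).const_mul _, Finset.mul_sum]
  refine Finset.sum_le_sum fun i _ => ?_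
  rw [lintegral_const_mul _ (hm i), mul_left_comm]
  exact mul_le_mul_right (lintegral_enorm_comp_le (hg i) hp hS ht.1
    (fun w hw => hBS w hw t ht) hB) _

/-- Morrey's estimate at the vertex `x` of a set `S` that contains the segments from `x` to the
points of `x + B`. -/
theorem volume_mul_enorm_le {f : Coord n → ℝ} (hf : ContDiff ℝ ∞ f) {p : ℝ} (hp : 1 ≤ p)
    {B S : Set (Coord n)} (hB : MeasurableSet B) (hS : MeasurableSet S) {x : Coord n}
    (hBS : ∀ w ∈ B, ∀ t ∈ Ioc (0 : ℝ) 1, x + t • w ∈ S) {h : ℝ} (hBh : ∀ w ∈ B, ‖w‖ ≤ h) :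
    volume B * ‖f x‖ₑ ≤ volume B ^ (1 - 1 / p) *
      (eLpNorm f (ENNReal.ofReal p) (volume.restrict S)
        + (ENNReal.ofReal h * ∫⁻ t in Ioc (0 : ℝ) 1, ENNReal.ofReal (t ^ (-(n : ℝ) / p)))
          * ∑ i, eLpNorm (pderiv i f) (ENNReal.ofReal p) (volume.restrict S)) := by
  set c := volume B ^ (1 - 1 / p)
  set N : Fin n → ℝ≥0∞ := fun i => eLpNorm (pderiv i f) (ENNReal.ofReal p) (volume.restrict S)
  have hpc : ∀ i, Continuous (pderiv i f) := fun i => (contDiff_pderiv hf i).continuous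
  have h1 : ∫⁻ w in B, ‖f (x + w)‖ₑ ≤
      eLpNorm f (ENNReal.ofReal p) (volume.restrict S) * c := by
    have := lintegral_enorm_comp_le hf.continuous hp hS (x := x) (t := 1) one_pos
      (fun w hw => hBS w hw 1 (by simp)) hB
    simp only [one_smul, Real.one_rpow, ENNReal.ofReal_one, one_mul] at this
    exact this
  have h2 : ∫⁻ w in B, ∫⁻ t in Ioc (0 : ℝ) 1, ∑ i, ENNReal.ofReal h * ‖pderiv i f (x + t • w)‖ₑ
      ≤ ∫⁻ t in Ioc (0 : ℝ) 1, ENNReal.ofReal (t ^ (-(n : ℝ) / p))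
        * (∑ i, ENNReal.ofReal h * (N i * c)) :=
    lintegral_lintegral_sum_le hpc hp hB hS hBS _
  calc volume B * ‖f x‖ₑ = ∫⁻ _ in B, ‖f x‖ₑ := by simp [mul_comm]
    _ ≤ ∫⁻ w in B, (‖f (x + w)‖ₑ
        + ∫⁻ t in Ioc (0 : ℝ) 1, ∑ i, ENNReal.ofReal h * ‖pderiv i f (x + t • w)‖ₑ) :=
        setLIntegral_mono' hB fun w hw => enorm_le_enorm_add_lintegral hf x w (hBh w hw)
    _ ≤ eLpNorm f (ENNReal.ofReal p) (volume.restrict S) * c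
        + ∫⁻ t in Ioc (0 : ℝ) 1, ENNReal.ofReal (t ^ (-(n : ℝ) / p))
        * (∑ i, ENNReal.ofReal h * (N i * c)) := by
        have hm : Measurable fun w => ‖f (x + w)‖ₑ :=
          (hf.continuous.comp (by fun_prop : Continuous fun w : Coord n => x + w)).enorm.measurable
        rw [lintegral_add_left hm]
        exact add_le_add h1 h2
    _ = _ := by
        rw [lintegral_mul_const _ (by fun_prop), ← Finset.mul_sum, ← Finset.sum_mul]
        ring

theorem lintegral_rpow_lt_top {p : ℝ} (hp : (n : ℝ) < p) :
    ∫⁻ t in Ioc (0 : ℝ) 1, ENNReal.ofReal (t ^ (-(n : ℝ) / p)) < ⊤ := by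
  have hp0 : 0 < p := lt_of_le_of_lt (Nat.cast_nonneg n) hp
  have h : IntervalIntegrable (fun t : ℝ => t ^ (-(n : ℝ) / p)) volume 0 1 := by
    apply intervalIntegral.intervalIntegrable_rpow'
    rw [lt_div_iff₀ hp0]
    linarith
  rw [intervalIntegrable_iff_integrableOn_Ioc_of_le zero_le_one] at h
  exact h.lintegral_lt_top

/-- A cone of height `h` with axis `v` contains the segments from its vertex to the points of a
closed ball whose radius depends only on the height and the aperture. -/
theorem mem_cone_of_mem_closedBall {h c : ℝ} (hh : 0 < h) (hc0 : 0 < c) (hc1 : c < 1)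
    {v w : Coord n} (hv : ‖v‖ = 1)
    (hw : w ∈ Metric.closedBall ((h / 2) • v) (h / 2 * (1 - c) / 4)) :
    ‖w‖ < h ∧ c * ‖w‖ < inner ℝ v w := by
  set s := h / 2 with hs
  set r := s * (1 - c) / 4 with hr
  have hs0 : 0 < s := by positivity
  have hd : ‖w - s • v‖ ≤ r := by simpa [dist_eq_norm] using hw
  have hsv : ‖s • v‖ = s := by rw [norm_smul, hv, mul_one, Real.norm_of_nonneg hs0.le]
  have hn : ‖w‖ ≤ s + r := by
    have := norm_add_le (s • v) (w - s • v)
    rw [add_sub_cancel, hsv] at this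
    linarith
  have hin : s - r ≤ inner ℝ v w := by
    have e : inner ℝ v w = s + inner ℝ v (w - s • v) := by
      rw [inner_sub_right, real_inner_smul_right, real_inner_self_eq_norm_sq, hv]; ring
    have := abs_real_inner_le_norm v (w - s • v)
    rw [hv, one_mul] at this
    have := neg_abs_le (inner ℝ v (w - s • v))
    linarith
  have h1 : 0 < s * (1 - c) := by nlinarith
  have h2 : 0 < s * c := by positivity
  refine ⟨by nlinarith, lt_of_le_of_lt (mul_le_mul_of_nonneg_left hn hc0.le) ?_⟩
  refine lt_of_lt_of_le ?_ hin
  have : 0 < s * (1 - c) * (1 - c) := mul_pos h1 (by linarith)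
  nlinarith

/-- The Sobolev embedding `W^{1,p} ⊂ L^∞` for `p > n` on open sets with the interior cone
condition, for functions that are continuous. -/
theorem ConeCondition.exists_abs_le {Ω : Set (Coord n)} (hΩ : IsOpen Ω) (hcone : ConeCondition Ω)
    {p : ℝ} (hp : (n : ℝ) < p) (hp1 : 1 ≤ p) {u : Coord n → ℝ} {du : Fin n → Coord n → ℝ}
    (hc : ContinuousOn u Ω) (hu : MemLpOn Ω p u) (hdu : ∀ i, MemLpOn Ω p (du i))
    (hgrad : HasWeakGrad Ω u du) : ∃ M : ℝ, ∀ x ∈ Ω, |u x| ≤ M := by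
  obtain ⟨h, c, hh, hc0, hc1, hcone⟩ := hcone
  set q := ENNReal.ofReal p with hq
  have hq1 : 1 ≤ q := by rw [hq, ← ENNReal.ofReal_one]; exact ENNReal.ofReal_le_ofReal hp1
  set r := h / 2 * (1 - c) / 4 with hr
  have hr0 : 0 < r := by
    have : 0 < 1 - c := by linarith
    positivity
  set b := volume (Metric.closedBall (0 : Coord n) r) with hb
  have hb0 : b ≠ 0 := (Metric.measure_closedBall_pos volume _ hr0).ne'
  have hbt : b ≠ ⊤ := measure_closedBall_lt_top.ne
  set I := ENNReal.ofReal h * ∫⁻ t in Ioc (0 : ℝ) 1, ENNReal.ofReal (t ^ (-(n : ℝ) / p)) with hI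
  have hIt : I ≠ ⊤ := ENNReal.mul_ne_top ENNReal.ofReal_ne_top (lintegral_rpow_lt_top hp).ne
  set M := b⁻¹ * (b ^ (1 - 1 / p) * (eLpNorm u q (volume.restrict Ω)
    + I * ∑ i, eLpNorm (du i) q (volume.restrict Ω))) with hM
  have hexp : 0 ≤ 1 - 1 / p := by
    rw [sub_nonneg, div_le_one (by linarith)]; exact hp1
  have hbe : b ^ (1 - 1 / p) ≠ ⊤ := ENNReal.rpow_ne_top_of_nonneg hexp hbt
  have hMt : M ≠ ⊤ := ENNReal.mul_ne_top (ENNReal.inv_ne_top.2 hb0) (ENNReal.mul_ne_top hbe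
    (ENNReal.add_ne_top.2 ⟨hu.2.ne, ENNReal.mul_ne_top hIt
      (ENNReal.sum_ne_top.2 fun i _ => (hdu i).2.ne)⟩))
  refine ⟨M.toReal, fun x hx => ?_⟩
  suffices hs : ‖u x‖ₑ ≤ M by
    have := ENNReal.toReal_mono hMt hs
    rwa [toReal_enorm] at this
  obtain ⟨v, hv, hvc⟩ := hcone x hx
  set B := Metric.closedBall ((h / 2) • v) r with hB
  have hBvol : volume B = b := by rw [hB, hb, Measure.addHaar_closedBall_center]
  -- The compact cone with vertex `x` over the ball `x + B`.
  set S := (fun z : ℝ × Coord n => x + z.1 • z.2) '' (Icc (0 : ℝ) 1 ×ˢ B) with hS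
  have hSc : IsCompact S :=
    (isCompact_Icc.prod (isCompact_closedBall _ _)).image (by fun_prop)
  have hmem : ∀ w ∈ B, ‖w‖ < h ∧ c * ‖w‖ < inner ℝ v w := fun w hw =>
    mem_cone_of_mem_closedBall hh hc0 hc1 hv hw
  have hSΩ : S ⊆ Ω := by
    rintro _ ⟨⟨t, w⟩, ⟨ht, hw⟩, rfl⟩
    obtain ⟨h1, h2⟩ := hmem w hw
    rcases ht.1.eq_or_lt with h0 | h0
    · subst h0
      simpa using hx
    · have e : ‖x + t • w - x‖ = t * ‖w‖ := by
        rw [add_sub_cancel_left, norm_smul, Real.norm_of_nonneg ht.1]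
      refine hvc _ ?_ ?_
      · rw [e]
        exact lt_of_le_of_lt (mul_le_of_le_one_left (norm_nonneg _) ht.2) h1
      · rw [e, add_sub_cancel_left, real_inner_smul_right]
        calc c * (t * ‖w‖) = t * (c * ‖w‖) := by ring
          _ < _ := mul_lt_mul_of_pos_left h2 h0
  have hSx : x ∈ S := ⟨(0, (h / 2) • v), ⟨by simp, Metric.mem_closedBall_self hr0.le⟩, by simp⟩
  obtain ⟨T, hT⟩ := exists_isCollar hSc hΩ hSΩ
  have hqt : q ≠ ⊤ := ENNReal.ofReal_ne_top
  have hle : ∀ {f : Coord n → ℝ}, MemLpOn Ω p f → ∀ k, eLpNorm (approx T k f) q (volume.restrict S)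
      ≤ eLpNorm (fun z => approx T k f z - f z) q (volume.restrict S)
        + eLpNorm f q (volume.restrict Ω) := by
    intro f hf k
    have hf1 := hf.locLp.mono_exponent hq1
    have hfS := hf.locLp S hSc hSΩ
    have ha : AEStronglyMeasurable (approx T k f) (volume.restrict S) :=
      (hT.contDiff_approx hf1 k).continuous.aestronglyMeasurable
    have e : approx T k f = (fun z => approx T k f z - f z) + f := by ext z; simp
    calc eLpNorm (approx T k f) q (volume.restrict S)
        = eLpNorm ((fun z => approx T k f z - f z) + f) q (volume.restrict S) := by rw [← e]
      _ ≤ _ := (eLpNorm_add_le (ha.sub hfS.1) hfS.1 hq1).trans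
          (add_le_add le_rfl (eLpNorm_mono_measure _ (Measure.restrict_mono hSΩ le_rfl)))
  have hlim : ∀ {f : Coord n → ℝ}, MemLpOn Ω p f → Tendsto (fun k =>
      eLpNorm (fun z => approx T k f z - f z) q (volume.restrict S)
        + eLpNorm f q (volume.restrict Ω)) atTop (𝓝 (eLpNorm f q (volume.restrict Ω))) := by
    intro f hf
    simpa using (hT.tendsto_approx hSc.measurableSet hq1 hqt hf.locLp).add_const
      (eLpNorm f q (volume.restrict Ω))
  have hu1 := hu.locLp.mono_exponent hq1
  have hk : ∀ᶠ k in atTop, b * ‖approx T k u x‖ₑ ≤ b ^ (1 - 1 / p) *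
      ((eLpNorm (fun z => approx T k u z - u z) q (volume.restrict S)
        + eLpNorm u q (volume.restrict Ω)) + I * ∑ i,
        (eLpNorm (fun z => approx T k (du i) z - du i z) q (volume.restrict S)
          + eLpNorm (du i) q (volume.restrict Ω))) := by
    filter_upwards [hT.ball_subset] with k hk
    have h1 := volume_mul_enorm_le (hT.contDiff_approx hu1 k) hp1 (B := B) (S := S) (x := x)
      measurableSet_closedBall hSc.measurableSet
      (fun w hw t ht => ⟨(t, w), ⟨⟨ht.1.le, ht.2⟩, hw⟩, rfl⟩) (fun w hw => (hmem w hw).1.le)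
    rw [hBvol] at h1
    refine h1.trans (mul_le_mul_right (add_le_add (hle hu k) (mul_le_mul_right
      (Finset.sum_le_sum fun i _ => ?_) _)) _)
    refine le_trans (le_of_eq (eLpNorm_congr_ae ?_)) (hle (hdu i) k)
    filter_upwards [ae_restrict_mem hSc.measurableSet] with z hz
    exact hgrad.pderiv_approx hT (hk z hz) i
  have hL : Tendsto (fun k => b * ‖approx T k u x‖ₑ) atTop (𝓝 (b * ‖u x‖ₑ)) := by
    refine ENNReal.Tendsto.const_mul (Tendsto.enorm ?_) (Or.inr hbt)
    rw [Metric.tendsto_atTop']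
    intro ε hε
    obtain ⟨N, hN⟩ := eventually_atTop.1 (hT.eventually_abs_approx_sub_le hc (half_pos hε))
    exact ⟨N, fun k hk => lt_of_le_of_lt (hN k hk.le x hSx) (half_lt_self hε)⟩
  have hR := ENNReal.Tendsto.const_mul ((hlim hu).add (ENNReal.Tendsto.const_mul
    (tendsto_finsetSum Finset.univ fun i _ => hlim (hdu i)) (Or.inr hIt))) (Or.inr hbe)
  have hfin := le_of_tendsto_of_tendsto hL hR hk
  rw [hM]
  calc ‖u x‖ₑ = b⁻¹ * (b * ‖u x‖ₑ) := by
        rw [← mul_assoc, ENNReal.inv_mul_cancel hb0 hbt, one_mul]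
    _ ≤ _ := mul_le_mul_right hfin _

/-! ### Global integrability -/

section

variable {y : OpenPartialHomeomorph (Coord n) (Coord n)}

theorem IsCoordTransformation.exists_abs_det_le (hy : IsCoordTransformation y)
    (hb : BoundedOn y.source (jac y)) :
    ∃ C : ℝ, ∀ x ∈ y.source, |(fderiv ℝ y x).det| ≤ C := by
  obtain ⟨M, hM⟩ := hb
  refine ⟨Nat.factorial n • M ^ n, fun x hx => ?_⟩
  set b := (EuclideanSpace.basisFun (Fin n) ℝ).toBasis with hbdef
  have h1 : (fderiv ℝ y x).det
      = (LinearMap.toMatrix b b (fderiv ℝ y x : Coord n →ₗ[ℝ] Coord n)).det :=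
    (LinearMap.det_toMatrix b _).symm
  have h2 := Matrix.det_le (A := LinearMap.toMatrix b b (fderiv ℝ y x : Coord n →ₗ[ℝ] Coord n))
    (abv := AbsoluteValue.abs) (x := M) fun i j => by
      have e : LinearMap.toMatrix b b (fderiv ℝ y x : Coord n →ₗ[ℝ] Coord n) i j = jac y i j x := by
        rw [hy.jac_eq hx, LinearMap.toMatrix_apply]
        simp [hbdef]
      rw [e]
      exact hM i j x hx
  rw [h1]
  simpa using h2

theorem boundedOn_of_forall {Ω : Set (Coord n)} {f : Fin n → Fin n → Coord n → ℝ}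
    (h : ∀ i j, ∃ M : ℝ, ∀ x ∈ Ω, |f i j x| ≤ M) : BoundedOn Ω f := by
  choose M hM using h
  refine ⟨∑ i, ∑ j, |M i j|, fun i j x hx => (hM i j x hx).trans ?_⟩
  refine (le_abs_self _).trans ?_
  refine le_trans (Finset.single_le_sum (f := fun j => |M i j|) (fun _ _ => abs_nonneg _)
    (Finset.mem_univ j)) ?_
  exact Finset.single_le_sum (f := fun i => ∑ j, |M i j|)
    (fun _ _ => Finset.sum_nonneg fun _ _ => abs_nonneg _) (Finset.mem_univ i)

theorem BoundedOn.memLp_top {Ω : Set (Coord n)} (hΩ : IsOpen Ω)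
    {f : Fin n → Fin n → Coord n → ℝ} (hb : BoundedOn Ω f) (hc : ∀ i j, ContinuousOn (f i j) Ω)
    (i j : Fin n) : MemLp (f i j) ⊤ (volume.restrict Ω) := by
  obtain ⟨M, hM⟩ := hb
  refine memLp_top_of_bound ((hc i j).aestronglyMeasurable hΩ.measurableSet) M ?_
  filter_upwards [ae_restrict_mem hΩ.measurableSet] with x hx using hM i j x hx

theorem MemW1p.exists_abs_le {Ω : Set (Coord n)} (hΩ : IsOpen Ω) (hcone : ConeCondition Ω) {p : ℝ}
    (hp : (n : ℝ) < p) (hp1 : 1 ≤ p) {u : Coord n → ℝ} {du : Fin n → Coord n → ℝ}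
    (hc : ContinuousOn u Ω) (hu : MemW1p Ω p u du) : ∃ M : ℝ, ∀ x ∈ Ω, |u x| ≤ M := by
  have hq1 : 1 ≤ ENNReal.ofReal p := by simpa using ENNReal.ofReal_le_ofReal hp1
  exact hcone.exists_abs_le hΩ hp hp1 hc hu.1 (fun i => (hu.2 i).1)
    (hasWeakGrad_of_hasWeakPDeriv (hu.1.locLp.mono_exponent hq1)
      (fun i => (hu.2 i).1.locLp.mono_exponent hq1) fun i => (hu.2 i).2)

/-- For a transformation with bounded Jacobian and bounded inverse Jacobian, the tensor law
preserves global integrability. -/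
theorem IsCoordTransformation.memLp_of_tensorLaw (hy : IsCoordTransformation y)
    (hJ : BoundedOn y.source (jac y)) (hK : BoundedOn y.source (invJac y))
    {Rx Ry : CurvatureComponents n} (hR : TensorLaw y Rx Ry) {q : ℝ≥0∞}
    (hRx : ∀ τ μ ν ρ, MemLp (Rx τ μ ν ρ) q (volume.restrict y.source)) (δ α β γ : Fin n) :
    MemLp (Ry δ α β γ) q (volume.restrict y.target) := by
  have hJt := hJ.memLp_top y.open_source hy.continuousOn_jac
  have hKt := hK.memLp_top y.open_source hy.continuousOn_invJac
  have hmul : ∀ {r : ℝ≥0∞} {f g : Coord n → ℝ}, MemLp f ⊤ (volume.restrict y.source) →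
      MemLp g r (volume.restrict y.source) →
      MemLp (fun x => f x * g x) r (volume.restrict y.source) :=
    fun hf hg => hg.mul' hf
  have h1 : MemLp (fun x => ∑ τ, ∑ μ, ∑ ν, ∑ ρ,
      jac y δ τ x * invJac y μ α x * invJac y ν β x * invJac y ρ γ x * Rx τ μ ν ρ x) q
      (volume.restrict y.source) :=
    memLp_finsetSum _ fun τ _ => memLp_finsetSum _ fun μ _ => memLp_finsetSum _ fun ν _ =>
      memLp_finsetSum _ fun ρ _ =>
        hmul (hmul (hmul (hmul (hJt δ τ) (hKt μ α)) (hKt ν β)) (hKt ρ γ)) (hRx τ μ ν ρ)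
  obtain ⟨C, hC⟩ := hy.exists_abs_det_le hJ
  have h2 := hy.memLp_comp_symm y.open_source.measurableSet subset_rfl hC h1
  rw [y.image_source_eq_target] at h2
  refine (memLp_congr_ae ?_).1 h2
  filter_upwards [hy.ae_tensorLaw hR] with z hz
  exact (hz δ α β γ).symm

end

end WeakCurvature

end

theorem mainTheorem5 (n : ℕ) (p : ℝ) (hp : (n : ℝ) < p)
    (y : OpenPartialHomeomorph (WeakCurvature.Coord n) (WeakCurvature.Coord n))
    (hy : WeakCurvature.IsCoordTransformation y)
    (dJ : Fin n → Fin n → Fin n → WeakCurvature.Coord n → ℝ)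
    (hJ : ∀ α ν : Fin n, WeakCurvature.MemW1p y.source p (WeakCurvature.jac y α ν) (dJ α ν))
    (Γx Γy : WeakCurvature.ConnectionComponents n)
    (hΓx : ∀ μ ρ ν : Fin n, WeakCurvature.MemLpOn y.source (2 * p) (Γx μ ρ ν))
    (hΓy : ∀ α β γ : Fin n, WeakCurvature.MemLpOn y.target (2 * p) (Γy α β γ))
    (hΓ : WeakCurvature.ConnectionLaw y dJ Γx Γy)
    (Rx Ry : WeakCurvature.CurvatureComponents n)
    (hRx : ∀ τ μ ν ρ : Fin n, WeakCurvature.MemLpOn y.source p (Rx τ μ ν ρ))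
    (hRiem : WeakCurvature.HasWeakRiem y.source Γx Rx)
    (hR : WeakCurvature.TensorLaw y Rx Ry) :
    (∀ δ α β γ : Fin n, WeakCurvature.MemLpLocOn y.target p (Ry δ α β γ)) ∧
    (((WeakCurvature.BoundedOn y.source (WeakCurvature.jac y) ∧
          WeakCurvature.BoundedOn y.source (WeakCurvature.invJac y)) ∨
        (WeakCurvature.ConeCondition y.source ∧
          ∀ μ α : Fin n, ∃ dK : Fin n → WeakCurvature.Coord n → ℝ,
            WeakCurvature.MemW1p y.source p (WeakCurvature.invJac y μ α) dK)) →
      ∀ δ α β γ : Fin n, WeakCurvature.MemLpOn y.target p (Ry δ α β γ)) ∧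
    WeakCurvature.HasWeakRiem y.target Γy Ry := by
  rcases Nat.eq_zero_or_pos n with rfl | hn
  -- There are no indices in dimension zero.
  · exact ⟨fun δ => δ.elim0, fun _ δ => δ.elim0, fun _ _ μ => μ.elim0⟩
  have hp1 : 1 ≤ p := le_trans (by exact_mod_cast hn) hp.le
  have hq1 : 1 ≤ ENNReal.ofReal p := by simpa using ENNReal.ofReal_le_ofReal hp1
  have hq2 : 2 ≤ ENNReal.ofReal (2 * p) := by
    simpa using ENNReal.ofReal_le_ofReal (show (2 : ℝ) ≤ 2 * p by linarith)
  refine ⟨hy.locLp_of_tensorLaw hR fun τ μ ν ρ => (hRx τ μ ν ρ).locLp, fun hb => ?_,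
    hy.hasWeakRiem (fun α ν => ?_) (fun μ ρ ν => (hΓx μ ρ ν).locLp.mono_exponent hq2)
      (fun α β γ => (hΓy α β γ).locLp.mono_exponent hq2) hΓ
      (fun τ μ ν ρ => (hRx τ μ ν ρ).locLp.mono_exponent hq1) hRiem hR⟩
  · obtain ⟨hb1, hb2⟩ : WeakCurvature.BoundedOn y.source (WeakCurvature.jac y) ∧
        WeakCurvature.BoundedOn y.source (WeakCurvature.invJac y) := by
      rcases hb with hb | ⟨hcone, hK⟩
      · exact hb
      · exact ⟨WeakCurvature.boundedOn_of_forall fun α ν =>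
            (hJ α ν).exists_abs_le y.open_source hcone hp hp1 (hy.continuousOn_jac α ν),
          WeakCurvature.boundedOn_of_forall fun μ α =>
            (hK μ α).choose_spec.exists_abs_le y.open_source hcone hp hp1
              (hy.continuousOn_invJac μ α)⟩
    exact hy.memLp_of_tensorLaw hb1 hb2 hR hRx
  · exact WeakCurvature.hasWeakGrad_of_hasWeakPDeriv
      ((hJ α ν).1.locLp.mono_exponent hq1)
      (fun i => ((hJ α ν).2 i).1.locLp.mono_exponent hq1) fun i => ((hJ α ν).2 i).2
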